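/- Let $n\ge 1$ and let $A$ be a real $n\times n$ matrix all of whose complex eigenvalues satisfy $|\lambda|>1$ (a dilation); put $b=|\det A|$ and fix $\lambda_-$ with $1<\lambda_-<\min\{|\lambda|:\lambda\in\sigma(A)\}$. Fix an ellipsoid $\Delta=\{x\in\mathbb R^n:|Px|<1\}$, with $P$ a non-degenerate matrix, such that $|\Delta|=1$ and $\Delta\subset r\Delta\subset A\Delta$ for some $r>1$; put $B_k=A^k\Delta$ for $k\in\mathbb Z$, let $\mathfrak B=\{x+B_k:x\in\mathbb R^n,\ k\in\mathbb Z\}$ be the family of dilated balls, and let $\rho(x)=\sum_{k\in\mathbb Z}b^k\chi_{B_{k+1}\setminus B_k}(x)$. Let $p(\cdot):\mathbb R^n\to(0,\infty)$ be measurable, $p_-=\operatorname{ess\,inf}p$, $p_+=\operatorname{ess\,sup}p$, with $0<p_-\le p_+\le 1$, and suppose that $p(\cdot)$ is globally log-Hölder continuous: there are $C_0,C_1>0$ and $p_\infty\in\mathbb R$ with $|p(x)-p(y)|\le C_0/\log(e+1/\rho(x-y))$ and $|p(x)-p_\infty|\le C_1/\log(e+\rho(x))$ for all $x,y\in\mathbb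 R^n$. Let $\|g\|_{L^{p(\cdot)}}=\inf\{t>0:\int_{\mathbb R^n}|g(x)/t|^{p(x)}\,dx\le1\}$. Let $s\ge0$ be an integer with $s\ge\lfloor(1/p_--1)\ln b/\ln\lambda_-\rfloor$. For a locally integrable (real- or complex-valued) $f$ and $B\in\mathfrak B$ let $P_B^s(f)$ be the unique polynomial of degree at most $s$ such that $\int_B h\,(f-P_B^s(f))\,dx=0$ for every polynomial $h$ of degree at most $s$, and let $\mathcal{BMO}_A^{p(\cdot),1,s}$ be the set of all locally integrable $f$ with $$\|f\|_{\mathcal{BMO}_A^{p(\cdot),1,s}}=\sup_{B\in\mathfrak B}\ \inf_{\deg P\le s}\ \frac1{\|\chi_B\|_{L^{p(\cdot)}}}\int_B|f(x)-P(x)|\,dx<\infty .$$ Then there are positive constants $c_1,c_2$, independent of $f$, such that for every $f\in\mathcal{BMO}_A^{p(\cdot),1,s}$, every $B\in\mathfrak B$ and every $\lambda\in(0,\infty)$, $$\bigl|\{x\in B:|f(x)-P_B^s(f)(x)|>\lambda\}\bigr|\le c_1\,|B|\exp\left\{-\frac{c_2\,\lambda\,|B|}{\|f\|_{\mathcal{BMO}_A^{p(\cdot),1,s}}\,\|\chi_B\|_{L^{p(\cdot)}}}\right\},$$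 where the right-hand side is read as $0$ if $\|f\|_{\mathcal{BMO}_A^{p(\cdot),1,s}}=0$. -/

import Mathlib

noncomputable section

namespace AnisoBMO

open MeasureTheory

/-- `A` is an (anisotropic) dilation: all its complex eigenvalues have modulus `> 1`. -/
def IsDilation {n : ℕ} (A : Matrix (Fin n) (Fin n) ℝ) : Prop :=
  ∀ z ∈ spectrum ℂ (A.map (fun t : ℝ => (t : ℂ))), 1 < ‖z‖

/-- `lm` is an admissible choice of `λ₋`: `1 < λ₋ < min {|λ| : λ ∈ σ(A)}`. -/
def IsLambdaMinus {n : ℕ} (A : Matrix (Fin n) (Fin n) ℝ) (lm : ℝ) : Prop :=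
  1 < lm ∧ ∀ z ∈ spectrum ℂ (A.map (fun t : ℝ => (t : ℂ))), lm < ‖z‖

/-- `Δ` is an admissible unit ellipsoid for `A`: `Δ = {x : |P x| < 1}` (Euclidean norm) for some
non-degenerate `P`, `Δ ⊆ r Δ ⊆ A Δ` for some `r > 1`, and `|Δ| = 1`. -/
def IsUnitEllipsoid {n : ℕ} (A : Matrix (Fin n) (Fin n) ℝ) (Δ : Set (Fin n → ℝ)) : Prop :=
  (∃ P : Matrix (Fin n) (Fin n) ℝ, IsUnit P.det ∧
      Δ = {x | ‖WithLp.toLp 2 (P.mulVec x)‖ < 1}) ∧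
    (∃ r : ℝ, 1 < r ∧ Δ ⊆ (fun x => r • x) '' Δ ∧
      (fun x => r • x) '' Δ ⊆ (fun x => A.mulVec x) '' Δ) ∧
    volume Δ = 1

/-- `B_k = A^k Δ`, for `k ∈ ℤ`. -/
def ballAt {n : ℕ} (A : Matrix (Fin n) (Fin n) ℝ) (Δ : Set (Fin n → ℝ)) (k : ℤ) :
    Set (Fin n → ℝ) :=
  (fun x => (A ^ k).mulVec x) '' Δ

/-- The family of all dilated balls `x + B_k`. -/
def dilatedBalls {n : ℕ} (A : Matrix (Fin n) (Fin n) ℝ) (Δ : Set (Fin n → ℝ)) :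
    Set (Set (Fin n → ℝ)) :=
  {B | ∃ (x : Fin n → ℝ) (k : ℤ), B = (fun y => x + y) '' ballAt A Δ k}

/-- The step homogeneous quasi-norm `ρ(x) = ∑_k b^k χ_{B_{k+1} \ B_k}(x)`, `b = |det A|`.
The origin lies in every `B_k`, so that `ρ(0) = 0`. -/
def stepNorm {n : ℕ} (A : Matrix (Fin n) (Fin n) ℝ) (Δ : Set (Fin n → ℝ)) (x : Fin n → ℝ) : ℝ :=
  ∑' k : ℤ, (ballAt A Δ (k + 1) \ ballAt A Δ k).indicator (fun _ => |A.det| ^ k) x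

/-- `p₋`, the essential infimum of `p`. -/
def pMinus {n : ℕ} (p : (Fin n → ℝ) → ℝ) : ℝ := essInf p volume

/-- `p₊`, the essential supremum of `p`. -/
def pPlus {n : ℕ} (p : (Fin n → ℝ) → ℝ) : ℝ := essSup p volume

/-- The variable exponents `p : ℝⁿ → (0, ∞)`, measurable with `0 < p₋ ≤ p₊ < ∞`. -/
structure IsExponent {n : ℕ} (p : (Fin n → ℝ) → ℝ) : Prop where
  measurable : Measurable p
  pos : ∀ x, 0 < p x
  pMinus_pos : 0 < pMinus p
  pPlus_finite : ∃ M : ℝ, ∀ᵐ x ∂(volume : Measure (Fin n → ℝ)), p x ≤ M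

/-- Globally log-Hölder continuous exponents. -/
def IsLogHolder {n : ℕ} (A : Matrix (Fin n) (Fin n) ℝ) (Δ : Set (Fin n → ℝ))
    (p : (Fin n → ℝ) → ℝ) : Prop :=
  IsExponent p ∧ ∃ C₀ C₁ pinf : ℝ, 0 < C₀ ∧ 0 < C₁ ∧
    (∀ x y, |p x - p y| ≤ C₀ / Real.log (Real.exp 1 + 1 / stepNorm A Δ (x - y))) ∧
    (∀ x, |p x - pinf| ≤ C₁ / Real.log (Real.exp 1 + stepNorm A Δ x))

/-- The modular `∫ |g(x)|^{p(x)} dx`. -/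
def modular {n : ℕ} (p g : (Fin n → ℝ) → ℝ) : ENNReal :=
  ∫⁻ x, ENNReal.ofReal (|g x| ^ p x)

/-- The Luxemburg quasi-norm of `L^{p(·)}`. -/
def varNorm {n : ℕ} (p g : (Fin n → ℝ) → ℝ) : ℝ :=
  sInf {t : ℝ | 0 < t ∧ modular p (fun x => g x / t) ≤ 1}

/-- `‖χ_B‖_{L^{p(·)}}`. -/
def chiNorm {n : ℕ} (p : (Fin n → ℝ) → ℝ) (B : Set (Fin n → ℝ)) : ℝ :=
  varNorm p (B.indicator (fun _ => 1))

/-- The value at a point of `ℝⁿ` of a polynomial with real or complex coefficients. -/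
def polyEval {𝕜 : Type*} [RCLike 𝕜] {n : ℕ} (P : MvPolynomial (Fin n) 𝕜) (x : Fin n → ℝ) : 𝕜 :=
  MvPolynomial.eval (fun i => ((x i : ℝ) : 𝕜)) P

/-- `f ∈ L^q_loc`. -/
def IsLqLoc {𝕜 : Type*} [RCLike 𝕜] {n : ℕ} (q : ℝ) (f : (Fin n → ℝ) → 𝕜) : Prop :=
  ∀ K : Set (Fin n → ℝ), IsCompact K → MemLp f (ENNReal.ofReal q) (volume.restrict K)

/-- `P` has degree at most `m` and `∫_B h (g - P) = 0` for all polynomials `h` of degree at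
most `m`. -/
def IsMinimizingPoly {𝕜 : Type*} [RCLike 𝕜] {n : ℕ} (B : Set (Fin n → ℝ)) (m : ℕ)
    (g : (Fin n → ℝ) → 𝕜) (P : MvPolynomial (Fin n) 𝕜) : Prop :=
  P.totalDegree ≤ m ∧ ∀ h : MvPolynomial (Fin n) 𝕜, h.totalDegree ≤ m →
    ∫ x in B, polyEval h x * (g x - polyEval P x) = 0

open Classical in
/-- The minimizing polynomial `P_B^m(g)`. -/
def minimizingPoly {𝕜 : Type*} [RCLike 𝕜] {n : ℕ} (B : Set (Fin n → ℝ)) (m : ℕ)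
    (g : (Fin n → ℝ) → 𝕜) : MvPolynomial (Fin n) 𝕜 :=
  if h : ∃ P, IsMinimizingPoly B m g P then h.choose else 0

/-- The quantity
`sup_B inf_{deg P ≤ s} (|B|^{1-1/q} / ‖χ_B‖_{L^{p(·)}}) (∫_B |f - P|^q)^{1/q}` in `[0, ∞]`. -/
def bmoENorm {𝕜 : Type*} [RCLike 𝕜] {n : ℕ} (A : Matrix (Fin n) (Fin n) ℝ)
    (Δ : Set (Fin n → ℝ)) (p : (Fin n → ℝ) → ℝ) (q : ℝ) (s : ℕ) (f : (Fin n → ℝ) → 𝕜) : ENNReal :=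
  ⨆ B ∈ dilatedBalls A Δ, ⨅ (P : MvPolynomial (Fin n) 𝕜) (_ : P.totalDegree ≤ s),
    ENNReal.ofReal (volume.real B ^ (1 - 1 / q) / chiNorm p B) *
      (∫⁻ x in B, ‖f x - polyEval P x‖ₑ ^ q) ^ (1 / q)

/-- `f ∈ BMO_A^{p(·),q,s}`. -/
def MemBMO {𝕜 : Type*} [RCLike 𝕜] {n : ℕ} (A : Matrix (Fin n) (Fin n) ℝ)
    (Δ : Set (Fin n → ℝ)) (p : (Fin n → ℝ) → ℝ) (q : ℝ) (s : ℕ) (f : (Fin n → ℝ) → 𝕜) : Prop :=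
  IsLqLoc q f ∧ bmoENorm A Δ p q s f < ⊤

/-- `‖f‖_{BMO_A^{p(·),q,s}}`, for `f` in the space. -/
def bmoNorm {𝕜 : Type*} [RCLike 𝕜] {n : ℕ} (A : Matrix (Fin n) (Fin n) ℝ)
    (Δ : Set (Fin n → ℝ)) (p : (Fin n → ℝ) → ℝ) (q : ℝ) (s : ℕ) (f : (Fin n → ℝ) → 𝕜) : ℝ :=
  (bmoENorm A Δ p q s f).toReal

end AnisoBMO

end

namespace AnisoBMO

open MeasureTheory Filter Topology
open scoped ENNReal

/-! The proof is a Calderón–Zygmund stopping argument, once the variable exponent has been removed.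
Since `p ≤ 1` almost everywhere and `p` is log-Hölder, `‖χ_B'‖ / |B'|` is at most a constant times
`‖χ_B‖ / |B|` for every ball `B'` inside the enlargement of `B` by `σ` scales
(`LogHolderScale.exists_chiNorm_le`). So on all such `B'` the function `f` has mean oscillation,
modulo polynomials of degree at most `s`, bounded by one number `N` comparable to `‖f‖ ‖χ_B‖ / |B|`.

With `N` fixed, the iteration `BallScale.john_nirenberg_iterate` runs as for classical BMO. Given a
good polynomial `Q` on a ball, take the largest small balls on which the average of `|f - Q|`
exceeds a fixed multiple of `N`. By Vitali covering, their enlargements have at most half the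
measure of the ball; off them `|f - Q|` is controlled almost everywhere by Lebesgue differentiation.
On each enlargement `Q` differs pointwise from the local polynomial by at most a multiple of `N`,
because the supremum of a polynomial on a ball is controlled by its mean there, uniformly over balls
(`exists_norm_polyEval_ballOf_le`). Each round raises the height by a multiple of `N` and halves the
measure.

The same polynomial estimate replaces `Q` by `P_B^s(f)`, as `P_B^s(f) - Q` and `f - Q` have equal
moments on `B`. Infima over polynomials are only nearly attained, so the argument uses `‖f‖ + ε`; at
the end `ε = ‖f‖` is taken, or `ε` tends to zero when the norm vanishes. -/

/-- A nested family of symmetric open sets `S k ⊆ ℝⁿ` of measure `b ^ k`, with the quasi-triangle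
property `S k + S k ⊆ S (k + σ)`, shrinking to the origin and exhausting the space. -/
structure BallScale {n : ℕ} (S : ℤ → Set (Fin n → ℝ)) (b : ℝ) (σ : ℕ) : Prop where
  one_lt : 1 < b
  isOpen : ∀ k, IsOpen (S k)
  zero_mem : ∀ k, (0 : Fin n → ℝ) ∈ S k
  neg_mem : ∀ k x, x ∈ S k → -x ∈ S k
  mono : Monotone S
  add_mem : ∀ k x y, x ∈ S k → y ∈ S k → x + y ∈ S (k + σ)
  volume_eq : ∀ k, volume (S k) = ENNReal.ofReal (b ^ k)
  isBounded : ∀ k, Bornology.IsBounded (S k)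
  small : ∀ ε > 0, ∃ k, S k ⊆ Metric.ball 0 ε
  exhaust : ∀ x, ∃ k, x ∈ S k

/-- The translate `x + S k`. -/
def ballOf {n : ℕ} (S : ℤ → Set (Fin n → ℝ)) (x : Fin n → ℝ) (k : ℤ) : Set (Fin n → ℝ) :=
  {y | y - x ∈ S k}

/-! ### Geometry of translated balls -/

namespace BallScale

variable {n : ℕ} {S : ℤ → Set (Fin n → ℝ)} {b : ℝ} {σ : ℕ}

theorem b_pos (h : BallScale S b σ) : 0 < b := zero_lt_one.trans h.one_lt

theorem zpow_pos (h : BallScale S b σ) (k : ℤ) : 0 < b ^ k := _root_.zpow_pos h.b_pos k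

theorem zpow_le (h : BallScale S b σ) {j k : ℤ} (hjk : j ≤ k) : b ^ j ≤ b ^ k :=
  zpow_le_zpow_right₀ h.one_lt.le hjk

theorem ofReal_zpow_add (h : BallScale S b σ) (j k : ℤ) :
    ENNReal.ofReal (b ^ (j + k)) = ENNReal.ofReal (b ^ j) * ENNReal.ofReal (b ^ k) := by
  rw [zpow_add₀ h.b_pos.ne', ENNReal.ofReal_mul (h.zpow_pos j).le]

theorem ofReal_zpow_ne_zero (h : BallScale S b σ) (k : ℤ) : ENNReal.ofReal (b ^ k) ≠ 0 := by
  simpa using h.zpow_pos k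

theorem isOpen_ballOf (h : BallScale S b σ) (x : Fin n → ℝ) (k : ℤ) : IsOpen (ballOf S x k) :=
  (h.isOpen k).preimage (continuous_id.sub continuous_const)

theorem measurableSet_ballOf (h : BallScale S b σ) (x : Fin n → ℝ) (k : ℤ) :
    MeasurableSet (ballOf S x k) := (h.isOpen_ballOf x k).measurableSet

theorem mem_self (h : BallScale S b σ) (x : Fin n → ℝ) (k : ℤ) : x ∈ ballOf S x k := by
  simpa [ballOf] using h.zero_mem k

theorem volume_ballOf (h : BallScale S b σ) (x : Fin n → ℝ) (k : ℤ) :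
    volume (ballOf S x k) = ENNReal.ofReal (b ^ k) := by
  rw [← h.volume_eq k]
  have : ballOf S x k = (fun y => y + (-x)) ⁻¹' S k := by
    ext y; simp [ballOf, sub_eq_add_neg]
  rw [this, measure_preimage_add_right]

theorem isBounded_ballOf (h : BallScale S b σ) (x : Fin n → ℝ) (k : ℤ) :
    Bornology.IsBounded (ballOf S x k) := by
  obtain ⟨R, hR⟩ := (h.isBounded k).subset_ball 0
  refine (Metric.isBounded_ball (x := x) (r := R)).subset fun y hy => ?_
  have := hR hy
  simpa [Metric.mem_ball, dist_eq_norm] using this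

theorem ballOf_subset (h : BallScale S b σ) {x y : Fin n → ℝ} {j k : ℤ} (hjk : j ≤ k)
    (hy : y ∈ ballOf S x k) : ballOf S y j ⊆ ballOf S x (k + σ) := by
  intro z hz
  have := h.add_mem k _ _ (h.mono hjk hz) hy
  simpa [ballOf] using this

theorem ballOf_mono (h : BallScale S b σ) (x : Fin n → ℝ) {j k : ℤ} (hjk : j ≤ k) :
    ballOf S x j ⊆ ballOf S x k := fun _ hy => h.mono hjk hy

theorem mem_comm (h : BallScale S b σ) {x y : Fin n → ℝ} {k : ℤ} :
    y ∈ ballOf S x k ↔ x ∈ ballOf S y k := by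
  constructor <;> intro hy <;> simpa [ballOf] using h.neg_mem _ _ hy

/-! ### Covering and the maximal inequality -/

/-- Vitali covering for the family of translates. -/
theorem exists_disjoint_cover (h : BallScale S b σ) (E : Set (Fin n → ℝ))
    (j : (Fin n → ℝ) → ℤ) (k₁ : ℤ) (hj : ∀ y ∈ E, j y ≤ k₁) :
    ∃ u ⊆ E, u.Countable ∧ u.PairwiseDisjoint (fun y => ballOf S y (j y)) ∧
      E ⊆ ⋃ y ∈ u, ballOf S y (j y + 1 + σ) := by
  -- Size is measured by `b ^ j y` with ratio `b`, so every translate meets a selected one that is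
  -- at most one scale smaller. That scale, and the `σ` lost in the quasi-triangle property, give
  -- the enlargement `1 + σ`.
  obtain ⟨u, huE, hud, hu⟩ := Vitali.exists_disjoint_subfamily_covering_enlargement
    (fun y => ballOf S y (j y)) E (fun y => b ^ j y) b h.one_lt
    (fun a _ => (h.zpow_pos _).le) (b ^ k₁) (fun a ha => h.zpow_le (hj a ha))
    (fun a _ => ⟨a, h.mem_self a _⟩)
  refine ⟨u, huE, hud.countable_of_isOpen (fun i _ => h.isOpen_ballOf _ _)
    (fun i _ => ⟨i, h.mem_self i _⟩), hud, fun z hz => ?_⟩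
  obtain ⟨y, hyu, ⟨w, hw1, hw2⟩, hδ⟩ := hu z hz
  have hle : j z ≤ j y + 1 := by
    have : b ^ j z ≤ b ^ (j y + 1) := by
      rw [zpow_add_one₀ h.b_pos.ne', mul_comm]; exact hδ
    exact (zpow_le_zpow_iff_right₀ h.one_lt).1 this
  refine Set.mem_biUnion hyu ?_
  have h1 : w ∈ ballOf S y (j y + 1) := h.ballOf_mono y (by omega) hw2
  exact h.ballOf_subset hle h1 (h.mem_comm.1 hw1)

/-- The total measure of disjoint sets on which the average of `F` is large. -/
theorem tsum_measure_le (h : BallScale S b σ) {W u : Set (Fin n → ℝ)}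
    {j : (Fin n → ℝ) → ℤ} (F : (Fin n → ℝ) → ℝ≥0∞) (c : ℝ≥0∞) (hu : u.Countable)
    (hd : u.PairwiseDisjoint (fun y => ballOf S y (j y)))
    (hW : ∀ y ∈ u, ballOf S y (j y) ⊆ W)
    (hc : ∀ y ∈ u, c * ENNReal.ofReal (b ^ j y) ≤ ∫⁻ z in ballOf S y (j y), F z) :
    c * ∑' y : u, ENNReal.ofReal (b ^ j y) ≤ ∫⁻ z in W, F z := by
  rw [← ENNReal.tsum_mul_left]
  calc ∑' y : u, c * ENNReal.ofReal (b ^ j y)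
      ≤ ∑' y : u, ∫⁻ z in ballOf S y (j y), F z := ENNReal.tsum_le_tsum fun y => hc y y.2
    _ = ∫⁻ z in ⋃ y ∈ u, ballOf S y (j y), F z :=
        (lintegral_biUnion hu (fun y _ => h.measurableSet_ballOf _ _) hd _).symm
    _ ≤ ∫⁻ z in W, F z := lintegral_mono_set (Set.iUnion₂_subset hW)

/-- The weak type `(1,1)` inequality of the maximal operator. -/
theorem weak_type (h : BallScale S b σ) (F : (Fin n → ℝ) → ℝ≥0∞) (c : ℝ≥0∞) (k₁ : ℤ) :
    c * volume {y | ∃ k ≤ k₁, c * ENNReal.ofReal (b ^ k) ≤ ∫⁻ z in ballOf S y k, F z} ≤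
      ENNReal.ofReal (b ^ (1 + σ : ℤ)) * ∫⁻ z, F z := by
  set E := {y | ∃ k ≤ k₁, c * ENNReal.ofReal (b ^ k) ≤ ∫⁻ z in ballOf S y k, F z} with hE
  choose! j hj1 hj2 using fun (y : Fin n → ℝ) (hy : y ∈ E) => hy
  obtain ⟨u, huE, huc, hud, hcov⟩ := h.exists_disjoint_cover E j k₁ hj1
  have h1 := h.tsum_measure_le (W := Set.univ) F c huc hud (fun _ _ => Set.subset_univ _)
    (fun y hy => hj2 y (huE hy))
  have h2 : volume E ≤ ENNReal.ofReal (b ^ (1 + σ : ℤ)) * ∑' y : u, ENNReal.ofReal (b ^ j y) := by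
    rw [← ENNReal.tsum_mul_left]
    refine (measure_mono hcov).trans ((measure_biUnion_le _ huc _).trans ?_)
    refine ENNReal.tsum_le_tsum fun y => ?_
    rw [h.volume_ballOf, ← h.ofReal_zpow_add]
    exact (congrArg (fun t : ℤ => ENNReal.ofReal (b ^ t)) (by ring)).le
  calc c * volume E
      ≤ c * (ENNReal.ofReal (b ^ (1 + σ : ℤ)) * ∑' y : u, ENNReal.ofReal (b ^ j y)) := by gcongr
    _ = ENNReal.ofReal (b ^ (1 + σ : ℤ)) * (c * ∑' y : u, ENNReal.ofReal (b ^ j y)) := by ring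
    _ ≤ _ := by gcongr; simpa using h1

theorem exists_ballOf_subset_nhds (h : BallScale S b σ) (y : Fin n → ℝ) (k₁ : ℤ)
    {U : Set (Fin n → ℝ)} (hU : U ∈ 𝓝 y) : ∃ k ≤ k₁, ballOf S y k ⊆ U := by
  obtain ⟨ε, hε, hεU⟩ := Metric.mem_nhds_iff.1 hU
  obtain ⟨k, hk⟩ := h.small ε hε
  refine ⟨min k k₁, min_le_right _ _, fun z hz => hεU ?_⟩
  have := hk (h.mono (min_le_left _ _) hz)
  simpa [Metric.mem_ball, dist_eq_norm] using this

/-! ### Lebesgue differentiation -/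

variable {E : Type*} [NormedAddCommGroup E]

theorem integrableOn_ballOf (h : BallScale S b σ) {g : (Fin n → ℝ) → E}
    (hg : LocallyIntegrable g) (x : Fin n → ℝ) (k : ℤ) : IntegrableOn g (ballOf S x k) :=
  (hg.integrableOn_isCompact (h.isBounded_ballOf x k).isCompact_closure).mono_set subset_closure

variable [NormedSpace ℝ E]

/-- A function is almost everywhere bounded by any bound on its small-scale averages. -/
theorem measure_gt_of_average_le_eq_zero (h : BallScale S b σ) {g : (Fin n → ℝ) → E}
    (hg : Integrable g) {K : ℝ} (hK : 0 ≤ K) (k₁ : ℤ) {δ : ℝ} (hδ : 0 < δ) :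
    volume {y | K + 4 * δ < ‖g y‖ ∧
      ∀ k ≤ k₁, ∫⁻ z in ballOf S y k, ‖g z‖ₑ ≤ ENNReal.ofReal K * ENNReal.ofReal (b ^ k)} = 0 := by
  set D := {y | K + 4 * δ < ‖g y‖ ∧
      ∀ k ≤ k₁, ∫⁻ z in ballOf S y k, ‖g z‖ₑ ≤ ENNReal.ofReal K * ENNReal.ofReal (b ^ k)} with hD
  have hδ0 : ENNReal.ofReal δ ≠ 0 := by simpa using hδ
  set M := ENNReal.ofReal (b ^ (1 + σ : ℤ)) with hM
  -- Approximate `g` in `L¹` by a continuous `φ` up to `η`. On `D` either `g - φ` or one of its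
  -- small-scale averages is at least `δ`: otherwise `φ` exceeds `K + 3δ` near `y`, while its
  -- averages are at most `K + δ`. Chebyshev and the weak type bound handle the two cases.
  have key : ∀ η : ℝ≥0∞, η ≠ 0 → ENNReal.ofReal δ * volume D ≤ (1 + M) * η := by
    intro η hη
    obtain ⟨φ, -, hφ, hφc, hφi⟩ := hg.exists_hasCompactSupport_lintegral_sub_le hη
    set F : (Fin n → ℝ) → ℝ≥0∞ := fun z => ‖g z - φ z‖ₑ with hF
    have hsub : D ⊆ {y | ENNReal.ofReal δ ≤ F y} ∪
        {y | ∃ k ≤ k₁, ENNReal.ofReal δ * ENNReal.ofReal (b ^ k) ≤ ∫⁻ z in ballOf S y k, F z} := by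
      rintro y ⟨hy1, hy2⟩
      by_contra hcon
      simp only [Set.mem_union, Set.mem_ofPred_eq, not_or, not_le, not_exists, not_and] at hcon
      obtain ⟨hc1, hc2⟩ := hcon
      have hd1 : ‖g y - φ y‖ < δ := by
        simp only [hF] at hc1
        rw [← ofReal_norm] at hc1
        exact (ENNReal.ofReal_lt_ofReal_iff hδ).1 hc1
      have hφy : K + 3 * δ < ‖φ y‖ := by
        have := norm_sub_norm_le (g y) (φ y)
        linarith
      have hU : {z | K + 3 * δ < ‖φ z‖} ∈ 𝓝 y :=
        (isOpen_lt continuous_const hφc.norm).mem_nhds hφy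
      obtain ⟨k, hk, hkU⟩ := h.exists_ballOf_subset_nhds y k₁ hU
      have h3 : ENNReal.ofReal (K + 3 * δ) * ENNReal.ofReal (b ^ k) ≤
          ∫⁻ z in ballOf S y k, ‖φ z‖ₑ := by
        rw [← h.volume_ballOf y k, ← setLIntegral_const]
        refine setLIntegral_mono' (h.measurableSet_ballOf _ _) fun z hz => ?_
        rw [← ofReal_norm]
        exact ENNReal.ofReal_le_ofReal (hkU hz).le
      have h4 : ∫⁻ z in ballOf S y k, ‖φ z‖ₑ ≤
          (∫⁻ z in ballOf S y k, ‖g z‖ₑ) + ∫⁻ z in ballOf S y k, F z := by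
        rw [← lintegral_add_left' hg.aestronglyMeasurable.restrict.enorm]
        refine lintegral_mono fun z => ?_
        rw [hF]
        calc ‖φ z‖ₑ = ‖g z - (g z - φ z)‖ₑ := by rw [sub_sub_cancel]
          _ ≤ _ := enorm_sub_le
      have h5 : ENNReal.ofReal (K + 3 * δ) * ENNReal.ofReal (b ^ k) ≤
          (ENNReal.ofReal K + ENNReal.ofReal δ) * ENNReal.ofReal (b ^ k) := by
        rw [add_mul]
        exact h3.trans (h4.trans (add_le_add (hy2 k hk) (hc2 k hk).le))
      rw [← ENNReal.ofReal_add hK hδ.le, ENNReal.mul_le_mul_iff_left (h.ofReal_zpow_ne_zero k)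
        ENNReal.ofReal_ne_top, ENNReal.ofReal_le_ofReal_iff (by positivity)] at h5
      linarith
    calc ENNReal.ofReal δ * volume D
        ≤ ENNReal.ofReal δ * (volume {y | ENNReal.ofReal δ ≤ F y} + volume {y | ∃ k ≤ k₁,
            ENNReal.ofReal δ * ENNReal.ofReal (b ^ k) ≤ ∫⁻ z in ballOf S y k, F z}) := by
          gcongr; exact (measure_mono hsub).trans (measure_union_le _ _)
      _ ≤ (∫⁻ z, F z) + M * ∫⁻ z, F z := by
          rw [mul_add]
          exact add_le_add (mul_meas_ge_le_lintegral₀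
            (hg.aestronglyMeasurable.sub hφi.aestronglyMeasurable).enorm _) (h.weak_type F _ k₁)
      _ = (1 + M) * ∫⁻ z, F z := by ring
      _ ≤ (1 + M) * η := by gcongr
  have hM1 : 1 + M ≠ ∞ := by simp [hM]
  have hz : ENNReal.ofReal δ * volume D = 0 := by
    by_contra hne
    have h0 : (1 + M) ≠ 0 := by simp
    rcases eq_or_ne (ENNReal.ofReal δ * volume D) ∞ with htop | htop
    · have := key 1 one_ne_zero
      rw [htop, mul_one, top_le_iff] at this
      exact hM1 this
    · have h2 := key (ENNReal.ofReal δ * volume D / 2 / (1 + M))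
        (ENNReal.div_ne_zero.2 ⟨ENNReal.div_ne_zero.2 ⟨hne, by simp⟩, hM1⟩)
      rw [ENNReal.mul_div_cancel h0 hM1] at h2
      exact absurd h2 (not_le.2 (ENNReal.half_lt_self hne htop))
  exact (mul_eq_zero.1 hz).resolve_left hδ0

/-- Lebesgue differentiation, in the form of an almost everywhere bound by averages. -/
theorem measure_lt_of_average_le_eq_zero (h : BallScale S b σ) {g : (Fin n → ℝ) → E}
    (hg : Integrable g) {K : ℝ} (hK : 0 ≤ K) (k₁ : ℤ) :
    volume {y | K < ‖g y‖ ∧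
      ∀ k ≤ k₁, ∫⁻ z in ballOf S y k, ‖g z‖ₑ ≤ ENNReal.ofReal K * ENNReal.ofReal (b ^ k)} = 0 := by
  refine measure_mono_null (t := ⋃ i : ℕ, {y | K + 4 * (1 / ((i : ℝ) + 1)) < ‖g y‖ ∧
      ∀ k ≤ k₁, ∫⁻ z in ballOf S y k, ‖g z‖ₑ ≤ ENNReal.ofReal K * ENNReal.ofReal (b ^ k)}) ?_
    (measure_iUnion_null fun i => h.measure_gt_of_average_le_eq_zero hg hK k₁ (by positivity))
  rintro y ⟨hy1, hy2⟩
  obtain ⟨i, hi⟩ := exists_nat_one_div_lt (show 0 < (‖g y‖ - K) / 4 by linarith)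
  exact Set.mem_iUnion.2 ⟨i, by linarith, hy2⟩

/-! ### The John–Nirenberg iteration -/

/-- The constant of the John–Nirenberg iteration. -/
noncomputable def jnConst (b C : ℝ) (σ : ℕ) : ℝ :=
  max (2 * b ^ (1 + σ : ℤ)) (C * (1 + 2 * b ^ (1 + σ : ℤ) + b ^ (2 * σ + 1 : ℤ)))

theorem jnConst_pos (h : BallScale S b σ) (C : ℝ) : 0 < jnConst b C σ :=
  lt_max_of_lt_left (mul_pos two_pos (h.zpow_pos _))

/-- The John–Nirenberg iteration for a class `𝒬` of functions playing the role of polynomials. -/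
theorem john_nirenberg_iterate (h : BallScale S b σ) {W : Set (Fin n → ℝ)}
    {f : (Fin n → ℝ) → E} (hf : LocallyIntegrable f) {𝒬 : Set ((Fin n → ℝ) → E)}
    (hcont : ∀ Q ∈ 𝒬, Continuous Q) {C : ℝ} (hC : 0 ≤ C)
    (hsup : ∀ Q ∈ 𝒬, ∀ Q' ∈ 𝒬, ∀ x k, ∀ y ∈ ballOf S x k,
      ‖Q y - Q' y‖ₑ * ENNReal.ofReal (b ^ k) ≤
        ENNReal.ofReal C * ∫⁻ z in ballOf S x k, ‖Q z - Q' z‖ₑ)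
    {N : ℝ} (hN : 0 < N)
    (hosc : ∀ x k, ballOf S x (k + σ) ⊆ W → ∃ Q ∈ 𝒬,
      ∫⁻ z in ballOf S x (k + σ), ‖f z - Q z‖ₑ ≤ ENNReal.ofReal N * ENNReal.ofReal (b ^ k))
    (m : ℕ) : ∀ x k, ballOf S x (k + σ) ⊆ W → ∀ Q ∈ 𝒬,
      ∫⁻ z in ballOf S x (k + σ), ‖f z - Q z‖ₑ ≤ ENNReal.ofReal N * ENNReal.ofReal (b ^ k) →
      volume {y | y ∈ ballOf S x k ∧ m * (jnConst b C σ * N) < ‖f y - Q y‖} ≤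
        2⁻¹ ^ m * ENNReal.ofReal (b ^ k) := by
  have hLpos := h.jnConst_pos C
  -- The induction quantifies over all balls and all admissible `Q`, because the next round uses the
  -- stopping balls with their own polynomials. The oscillation hypothesis sits `σ` scales above the
  -- conclusion so that it sees every ball of scale at most `k` centred in the smaller one.
  induction m with
  | zero =>
    intro x k _ Q _ _
    rw [pow_zero, one_mul, ← h.volume_ballOf x k]
    exact measure_mono fun y hy => hy.1
  | succ m ih =>
    intro x k hxW Q hQ hQN
    -- In the threshold, `b ^ (1 + σ)` pays for the Vitali enlargement and `2` yields the halving.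
    set K : ℝ := 2 * b ^ (1 + σ : ℤ) with hKdef
    have hKpos : 0 < K := mul_pos two_pos (h.zpow_pos _)
    set L := jnConst b C σ with hL
    -- An enlarged stopping ball has scale `j + 1 + σ`, and the induction hypothesis looks `σ`
    -- scales higher; `j ≤ k₁` keeps that scale at most `k`, hence the ball inside `W'`.
    set k₁ : ℤ := k - (2 * σ + 1) with hk₁
    have hKN : 0 ≤ K * N := by positivity
    set W' := ballOf S x (k + σ) with hW'
    have hgloc : LocallyIntegrable (fun z => f z - Q z) :=
      hf.sub (hcont Q hQ).locallyIntegrable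
    set g : (Fin n → ℝ) → E := W'.indicator (fun z => f z - Q z) with hg
    have hgi : Integrable g := (integrable_indicator_iff (h.measurableSet_ballOf _ _)).2
      (h.integrableOn_ballOf hgloc x _)
    set D := {y | y ∈ ballOf S x k ∧ ∃ j ≤ k₁, ENNReal.ofReal (K * N) * ENNReal.ofReal (b ^ j) <
      ∫⁻ z in ballOf S y j, ‖f z - Q z‖ₑ} with hD
    -- Stopping rule: the largest bad scale is chosen, so every larger scale up to `k₁` has a
    -- controlled average.
    have hmax : ∀ y ∈ D, ∃ j ≤ k₁, (ENNReal.ofReal (K * N) * ENNReal.ofReal (b ^ j) <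
      ∫⁻ z in ballOf S y j, ‖f z - Q z‖ₑ) ∧ ∀ i ≤ k₁, j < i →
        ∫⁻ z in ballOf S y i, ‖f z - Q z‖ₑ ≤ ENNReal.ofReal (K * N) * ENNReal.ofReal (b ^ i) := by
      rintro y ⟨-, hy⟩
      obtain ⟨j, hj, hjm⟩ := Int.exists_greatest_of_bdd (P := fun j => j ≤ k₁ ∧
        ENNReal.ofReal (K * N) * ENNReal.ofReal (b ^ j) < ∫⁻ z in ballOf S y j, ‖f z - Q z‖ₑ)
        ⟨k₁, fun z hz => hz.1⟩ hy
      refine ⟨j, hj.1, hj.2, fun i hi hji => ?_⟩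
      by_contra hcon
      exact absurd (hjm i ⟨hi, not_le.1 hcon⟩) (not_le.2 hji)
    choose! j hj1 hj2 hj3 using hmax
    obtain ⟨u, huD, huc, hud, hcov⟩ := h.exists_disjoint_cover D j k₁ hj1
    have hsubW' : ∀ y ∈ ballOf S x k, ∀ i ≤ k, ballOf S y i ⊆ W' :=
      fun y hy i hi => h.ballOf_subset hi hy
    have hsum : ∑' y : u, ENNReal.ofReal (b ^ (j y + 1 + σ)) ≤ 2⁻¹ * ENNReal.ofReal (b ^ k) := by
      have h1 := h.tsum_measure_le (W := W') (fun z => ‖f z - Q z‖ₑ) (ENNReal.ofReal (K * N)) huc hud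
        (fun y hy => hsubW' y (huD hy).1 _ (by have := hj1 y (huD hy); omega))
        (fun y hy => (hj2 y (huD hy)).le)
      have h2 := h1.trans hQN
      have h3 : ENNReal.ofReal N * (2 * ∑' y : u, ENNReal.ofReal (b ^ (j y + 1 + σ))) =
          ENNReal.ofReal (K * N) * ∑' y : u, ENNReal.ofReal (b ^ j y) := by
        have : ∀ y : u, ENNReal.ofReal (b ^ (j y + 1 + σ)) =
            ENNReal.ofReal (b ^ (1 + σ : ℤ)) * ENNReal.ofReal (b ^ j y) := fun y => by
          rw [← h.ofReal_zpow_add]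
          exact congrArg (fun t : ℤ => ENNReal.ofReal (b ^ t)) (by ring)
        simp_rw [this]
        rw [ENNReal.tsum_mul_left, ENNReal.ofReal_mul hKpos.le, hKdef,
          ENNReal.ofReal_mul two_pos.le, ENNReal.ofReal_ofNat]
        ring
      rw [← h3, ENNReal.mul_le_mul_iff_right (by simpa using hN) ENNReal.ofReal_ne_top] at h2
      rw [← one_mul (∑' y : u, _), ← ENNReal.inv_mul_cancel two_ne_zero ENNReal.ofNat_ne_top,
        mul_assoc]
      gcongr
    have hnull : volume {y | y ∈ ballOf S x k ∧ y ∉ D ∧ K * N < ‖f y - Q y‖} = 0 := by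
      refine measure_mono_null ?_ (h.measure_lt_of_average_le_eq_zero hgi hKN k₁)
      rintro y ⟨hy1, hy2, hy3⟩
      refine ⟨?_, fun i hi => ?_⟩
      · have : y ∈ W' := hsubW' y hy1 k le_rfl (h.mem_self y k)
        rwa [hg, Set.indicator_of_mem this]
      · by_contra hcon
        refine hy2 ⟨hy1, i, hi, ?_⟩
        refine (not_le.1 hcon).trans_le (lintegral_mono fun z => ?_)
        by_cases hz : z ∈ W' <;> simp [hg, hz]
    have hball : ∀ y ∈ u, volume {z | z ∈ ballOf S y (j y + 1 + σ) ∧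
        (m + 1 : ℕ) * (L * N) < ‖f z - Q z‖} ≤
          2⁻¹ ^ m * ENNReal.ofReal (b ^ (j y + 1 + σ)) := by
      intro y hy
      have hjy := hj1 y (huD hy)
      set ℓ := j y + 1 + σ with hℓ
      have hyk := (huD hy).1
      have hyW' : ballOf S y (ℓ + σ) ⊆ W' := hsubW' y hyk _ (by omega)
      obtain ⟨Q', hQ', hQ'N⟩ := hosc y ℓ (hyW'.trans hxW)
      refine (measure_mono ?_).trans (ih y ℓ (hyW'.trans hxW) Q' hQ' hQ'N)
      rintro z ⟨hz1, hz2⟩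
      refine ⟨hz1, ?_⟩
      -- Both polynomials are close to `f` in mean on the enlarged ball, hence close to each other
      -- in mean, and `hsup` makes this pointwise.
      have hdiff : ‖Q' z - Q z‖ ≤ L * N := by
        have e1 : ∫⁻ z in ballOf S y ℓ, ‖f z - Q' z‖ₑ ≤
            ENNReal.ofReal N * ENNReal.ofReal (b ^ ℓ) :=
          (lintegral_mono_set (h.ballOf_mono y (by omega))).trans hQ'N
        have e2 : ∫⁻ z in ballOf S y ℓ, ‖f z - Q z‖ₑ ≤
            ENNReal.ofReal ((K + b ^ (2 * σ + 1 : ℤ)) * N) * ENNReal.ofReal (b ^ ℓ) := by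
          -- Up to scale `k₁` maximality of `j y` applies. Above it the ball has measure comparable
          -- to `b ^ k`, up to `b ^ (2σ + 1)`, and the bound on `W'` suffices.
          rcases le_or_gt ℓ k₁ with hle | hgt
          · refine (hj3 y (huD hy) ℓ hle (by omega)).trans ?_
            gcongr
            have := (h.zpow_pos (2 * σ + 1)).le
            linarith
          · refine (lintegral_mono_set (hsubW' y hyk ℓ (by omega))).trans (hQN.trans ?_)
            rw [← ENNReal.ofReal_mul hN.le, ← ENNReal.ofReal_mul
              (mul_nonneg (add_nonneg hKpos.le (h.zpow_pos _).le) hN.le)]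
            refine ENNReal.ofReal_le_ofReal ?_
            have hb1 : b ^ k ≤ b ^ (2 * σ + 1 : ℤ) * b ^ ℓ := by
              rw [← zpow_add₀ h.b_pos.ne']
              exact h.zpow_le (by omega)
            have hb2 := h.zpow_pos ℓ
            calc N * b ^ k ≤ N * (b ^ (2 * σ + 1 : ℤ) * b ^ ℓ) := by gcongr
              _ ≤ N * (b ^ (2 * σ + 1 : ℤ) * b ^ ℓ) + K * N * b ^ ℓ := by
                  linarith [mul_nonneg hKN hb2.le]
              _ = _ := by ring
        have e3 : ∫⁻ z in ballOf S y ℓ, ‖Q' z - Q z‖ₑ ≤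
            ENNReal.ofReal ((1 + K + b ^ (2 * σ + 1 : ℤ)) * N) * ENNReal.ofReal (b ^ ℓ) := by
          calc ∫⁻ z in ballOf S y ℓ, ‖Q' z - Q z‖ₑ
              ≤ ∫⁻ z in ballOf S y ℓ, (‖f z - Q z‖ₑ + ‖f z - Q' z‖ₑ) := by
                refine lintegral_mono fun z => ?_
                calc ‖Q' z - Q z‖ₑ = ‖(f z - Q z) - (f z - Q' z)‖ₑ := by congr 1; abel
                  _ ≤ _ := enorm_sub_le
            _ = (∫⁻ z in ballOf S y ℓ, ‖f z - Q z‖ₑ) + ∫⁻ z in ballOf S y ℓ, ‖f z - Q' z‖ₑ :=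
                lintegral_add_left' hgloc.aestronglyMeasurable.restrict.enorm _
            _ ≤ ENNReal.ofReal ((K + b ^ (2 * σ + 1 : ℤ)) * N) * ENNReal.ofReal (b ^ ℓ) +
                ENNReal.ofReal N * ENNReal.ofReal (b ^ ℓ) := add_le_add e2 e1
            _ = _ := by
                rw [← add_mul, ← ENNReal.ofReal_add
                  (mul_nonneg (add_nonneg hKpos.le (h.zpow_pos _).le) hN.le) hN.le]
                congr 2; ring
        have e4 := (hsup Q' hQ' Q hQ y ℓ z hz1).trans (mul_le_mul_right e3 _)
        rw [← mul_assoc, ENNReal.mul_le_mul_iff_left (h.ofReal_zpow_ne_zero ℓ)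
          ENNReal.ofReal_ne_top, ← ENNReal.ofReal_mul hC, ← ofReal_norm,
          ENNReal.ofReal_le_ofReal_iff (mul_nonneg hC (mul_nonneg
            (add_nonneg (by positivity) (h.zpow_pos _).le) hN.le)), ← mul_assoc] at e4
        exact e4.trans (mul_le_mul_of_nonneg_right (le_max_right _ _) hN.le)
      have : ‖f z - Q z‖ ≤ ‖f z - Q' z‖ + ‖Q' z - Q z‖ := by
        simpa using norm_add_le (f z - Q' z) (Q' z - Q z)
      push_cast at hz2
      linarith
    have hsub : {y | y ∈ ballOf S x k ∧ (m + 1 : ℕ) * (L * N) < ‖f y - Q y‖} ⊆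
        {y | y ∈ ballOf S x k ∧ y ∉ D ∧ K * N < ‖f y - Q y‖} ∪
        ⋃ y ∈ u, {z | z ∈ ballOf S y (j y + 1 + σ) ∧ (m + 1 : ℕ) * (L * N) < ‖f z - Q z‖} := by
      rintro z ⟨hz1, hz2⟩
      by_cases hzD : z ∈ D
      · obtain ⟨y, hy, hzy⟩ := Set.mem_iUnion₂.1 (hcov hzD)
        exact Or.inr (Set.mem_biUnion hy ⟨hzy, hz2⟩)
      · refine Or.inl ⟨hz1, hzD, lt_of_le_of_lt ?_ hz2⟩
        have h1 : K * N ≤ L * N := mul_le_mul_of_nonneg_right (le_max_left _ _) hN.le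
        have h2 : 0 ≤ m * (L * N) := by positivity
        push_cast
        linarith
    calc volume {y | y ∈ ballOf S x k ∧ (m + 1 : ℕ) * (L * N) < ‖f y - Q y‖}
        ≤ 0 + ∑' y : u, 2⁻¹ ^ m * ENNReal.ofReal (b ^ (j y + 1 + σ)) := by
          refine (measure_mono hsub).trans ((measure_union_le _ _).trans ?_)
          rw [hnull]
          gcongr
          exact (measure_biUnion_le _ huc _).trans (ENNReal.tsum_le_tsum fun y => hball y y.2)
      _ = 2⁻¹ ^ m * ∑' y : u, ENNReal.ofReal (b ^ (j y + 1 + σ)) := by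
          rw [zero_add, ENNReal.tsum_mul_left]
      _ ≤ 2⁻¹ ^ m * (2⁻¹ * ENNReal.ofReal (b ^ k)) := by gcongr
      _ = _ := by rw [pow_succ, mul_assoc]

end BallScale

end AnisoBMO

/-! ### The dilated ellipsoids -/

namespace AnisoBMO

open MeasureTheory Filter Topology
open scoped ENNReal Pointwise

section Ellipsoid

variable {n : ℕ} {A : Matrix (Fin n) (Fin n) ℝ} {Δ : Set (Fin n → ℝ)}

theorem det_zpow_eq (k : ℤ) : (A ^ k).det = A.det ^ k := by
  cases k with
  | ofNat m => simp
  | negSucc m =>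
    rw [zpow_negSucc, zpow_negSucc, Matrix.det_nonsing_inv, Matrix.det_pow,
      Ring.inverse_eq_inv']

theorem mem_ballAt (hA : IsUnit A.det) {k : ℤ} {x : Fin n → ℝ} :
    x ∈ ballAt A Δ k ↔ (A ^ (-k)).mulVec x ∈ Δ := by
  constructor
  · rintro ⟨y, hy, rfl⟩
    simpa [Matrix.mulVec_mulVec, ← Matrix.zpow_add hA] using hy
  · intro h
    exact ⟨_, h, by simp [Matrix.mulVec_mulVec, ← Matrix.zpow_add hA]⟩

theorem volume_ballAt_eq (hv : volume Δ = 1) (k : ℤ) :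
    volume (ballAt A Δ k) = ENNReal.ofReal (|A.det| ^ k) := by
  have := Measure.addHaar_image_linearMap volume (Matrix.toLin' (A ^ k)) Δ
  rw [LinearMap.det_toLin', det_zpow_eq, abs_zpow, hv, mul_one] at this
  exact this

namespace IsUnitEllipsoid

theorem smul_mem (h : IsUnitEllipsoid A Δ) {x : Fin n → ℝ} (hx : x ∈ Δ) {t : ℝ}
    (ht : |t| ≤ 1) : t • x ∈ Δ := by
  obtain ⟨⟨P, -, rfl⟩, -⟩ := h
  simp only [Set.mem_ofPred_eq, Matrix.mulVec_smul, WithLp.toLp_smul, norm_smul,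
    Real.norm_eq_abs] at hx ⊢
  nlinarith [norm_nonneg (WithLp.toLp 2 (P.mulVec x)), abs_nonneg t]

theorem half_add_mem (h : IsUnitEllipsoid A Δ) {x y : Fin n → ℝ} (hx : x ∈ Δ) (hy : y ∈ Δ) :
    (2⁻¹ : ℝ) • (x + y) ∈ Δ := by
  obtain ⟨⟨P, -, rfl⟩, -⟩ := h
  simp only [Set.mem_ofPred_eq, Matrix.mulVec_smul, WithLp.toLp_smul, norm_smul,
    Real.norm_eq_abs, Matrix.mulVec_add, WithLp.toLp_add] at hx hy ⊢
  have := norm_add_le (WithLp.toLp 2 (P.mulVec x)) (WithLp.toLp 2 (P.mulVec y))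
  rw [abs_of_pos (by norm_num)]
  linarith

theorem isOpen (h : IsUnitEllipsoid A Δ) : IsOpen Δ := by
  obtain ⟨⟨P, -, rfl⟩, -⟩ := h
  refine isOpen_lt (Continuous.norm ?_) continuous_const
  exact (PiLp.continuous_toLp 2 _).comp (Continuous.matrix_mulVec continuous_const continuous_id)

theorem zero_mem (h : IsUnitEllipsoid A Δ) : (0 : Fin n → ℝ) ∈ Δ := by
  obtain ⟨⟨P, -, rfl⟩, -⟩ := h
  simp

theorem isBounded (h : IsUnitEllipsoid A Δ) : Bornology.IsBounded Δ := by
  obtain ⟨⟨P, hP, rfl⟩, -⟩ := h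
  have hc : IsCompact ((fun v : EuclideanSpace ℝ (Fin n) => P⁻¹.mulVec (WithLp.ofLp v)) ''
      Metric.closedBall 0 1) :=
    (isCompact_closedBall _ _).image
      (Continuous.matrix_mulVec continuous_const (PiLp.continuous_ofLp 2 _))
  refine hc.isBounded.subset fun x hx => ⟨WithLp.toLp 2 (P.mulVec x), ?_, ?_⟩
  · simpa using le_of_lt hx
  · simp [Matrix.mulVec_mulVec, Matrix.nonsing_inv_mul _ hP]

/-- A singular `A` would map `Δ` to a null set, yet this image contains `Δ`, of measure one. -/
theorem isUnit_det (h : IsUnitEllipsoid A Δ) : IsUnit A.det := by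
  rw [isUnit_iff_ne_zero]
  intro h0
  obtain ⟨-, ⟨r, -, h1, h2⟩, hv⟩ := h
  have := Measure.addHaar_image_linearMap volume (Matrix.toLin' A) Δ
  rw [LinearMap.det_toLin', h0, abs_zero, ENNReal.ofReal_zero, zero_mul] at this
  have h3 : volume Δ ≤ 0 := by
    rw [← this]
    exact measure_mono (h1.trans h2)
  simp [hv] at h3

theorem one_lt_det (h : IsUnitEllipsoid A Δ) (hn : 1 ≤ n) : 1 < |A.det| := by
  obtain ⟨-, ⟨r, hr, h1, h2⟩, hv⟩ := h
  have e1 := Measure.addHaar_image_linearMap volume (Matrix.toLin' A) Δ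
  have e2 := Measure.addHaar_smul volume r Δ
  rw [LinearMap.det_toLin', hv, mul_one] at e1
  rw [hv, mul_one, Module.finrank_pi, Fintype.card_fin] at e2
  have h3 : volume (r • Δ) ≤ volume ((Matrix.toLin' A) '' Δ) :=
    measure_mono h2
  rw [e1, e2, ENNReal.ofReal_le_ofReal_iff (abs_nonneg _)] at h3
  have : 1 < r ^ n := one_lt_pow₀ hr (by omega)
  linarith [le_abs_self (r ^ n)]

/-- Expansion of the dilated ellipsoids. -/
theorem exists_expand (h : IsUnitEllipsoid A Δ) : ∃ r : ℝ, 1 < r ∧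
    ∀ (k : ℤ) (m : ℕ) (x : Fin n → ℝ), x ∈ ballAt A Δ k → r ^ m • x ∈ ballAt A Δ (k + m) := by
  have hA := h.isUnit_det
  obtain ⟨-, ⟨r, hr, -, h2⟩, -⟩ := h
  refine ⟨r, hr, fun k m x hx => ?_⟩
  induction m with
  | zero => simpa using hx
  | succ m ih =>
    obtain ⟨y, hy, hyx⟩ := ih
    obtain ⟨z, hz, hzy⟩ := h2 ⟨y, hy, rfl⟩
    refine ⟨z, hz, ?_⟩
    have e : A ^ (k + (m + 1 : ℕ)) = A ^ (k + m) * A := by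
      rw [← Matrix.zpow_add_one hA]; push_cast; rw [add_assoc]
    simp only at hzy hyx ⊢
    rw [e, ← Matrix.mulVec_mulVec, hzy, Matrix.mulVec_smul, hyx, smul_smul, pow_succ, mul_comm]

theorem smul_mem_ballAt (h : IsUnitEllipsoid A Δ) {k : ℤ} {x : Fin n → ℝ}
    (hx : x ∈ ballAt A Δ k) {t : ℝ} (ht : |t| ≤ 1) : t • x ∈ ballAt A Δ k := by
  rw [mem_ballAt h.isUnit_det] at hx ⊢
  rw [Matrix.mulVec_smul]
  exact h.smul_mem hx ht

/-- All properties rest on `r ^ m • B_k ⊆ B_(k+m)` and on `Δ` being convex and symmetric. The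
midpoint of two points of `B_k` stays in `B_k`, so any `σ` with `r ^ σ > 2` gives the quasi-triangle
property. -/
theorem exists_ballScale (h : IsUnitEllipsoid A Δ) (hn : 1 ≤ n) :
    ∃ σ : ℕ, BallScale (ballAt A Δ) |A.det| σ := by
  have hA := h.isUnit_det
  obtain ⟨r, hr, hexp⟩ := h.exists_expand
  have hr0 : 0 < r := by linarith
  obtain ⟨σ, hσ⟩ := pow_unbounded_of_one_lt 2 hr
  have hmono : Monotone (ballAt A Δ) := by
    intro j k hjk x hx
    obtain ⟨m, rfl⟩ := Int.le.dest hjk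
    have h1 := h.smul_mem_ballAt (hexp j m x hx) (t := (r ^ m)⁻¹) (by
      rw [abs_of_pos (by positivity)]
      exact inv_le_one_of_one_le₀ (one_le_pow₀ hr.le))
    rwa [smul_smul, inv_mul_cancel₀ (by positivity), one_smul] at h1
  have hS0 : ballAt A Δ 0 = Δ := by simp [ballAt]
  refine ⟨σ, h.one_lt_det hn, fun k => ?_, fun k => ?_, fun k x hx => ?_, hmono,
    fun k x y hx hy => ?_, volume_ballAt_eq h.2.2, fun k => ?_, fun ε hε => ?_, fun x => ?_⟩
  · have : ballAt A Δ k = (fun x => (A ^ (-k)).mulVec x) ⁻¹' Δ := by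
      ext x; exact mem_ballAt hA
    rw [this]
    exact h.isOpen.preimage (Continuous.matrix_mulVec continuous_const continuous_id)
  · exact ⟨0, h.zero_mem, by simp⟩
  · simpa using h.smul_mem_ballAt hx (t := -1) (by simp)
  · have h1 : (2⁻¹ : ℝ) • (x + y) ∈ ballAt A Δ k := by
      rw [mem_ballAt hA] at hx hy ⊢
      rw [Matrix.mulVec_smul, Matrix.mulVec_add]
      exact h.half_add_mem hx hy
    have h2 := h.smul_mem_ballAt (hexp k σ _ h1) (t := 2 / r ^ σ) (by
      rw [abs_of_pos (by positivity)]
      exact div_le_one_of_le₀ hσ.le (by positivity))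
    rwa [smul_smul, smul_smul, div_mul_cancel₀ _ (by positivity), mul_inv_cancel₀ two_ne_zero,
      one_smul] at h2
  · exact (h.isBounded.isCompact_closure.image (Continuous.matrix_mulVec continuous_const
      continuous_id)).isBounded.subset (Set.image_mono subset_closure)
  · obtain ⟨R, hR⟩ := h.isBounded.subset_ball 0
    obtain ⟨m, hm⟩ := pow_unbounded_of_one_lt (R / ε) hr
    refine ⟨-m, fun x hx => ?_⟩
    have h1 := hexp _ m _ hx
    rw [neg_add_cancel, hS0] at h1
    have h2 := hR h1
    rw [mem_ball_zero_iff, norm_smul, Real.norm_eq_abs, abs_of_pos (by positivity)] at h2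
    rw [mem_ball_zero_iff]
    rw [div_lt_iff₀ hε] at hm
    exact lt_of_mul_lt_mul_left (h2.trans hm) (by positivity)
  · have hU : Δ ∈ 𝓝 (0 : Fin n → ℝ) := h.isOpen.mem_nhds h.zero_mem
    have ht : Tendsto (fun m : ℕ => (r⁻¹ ^ m) • x) atTop (𝓝 0) := by
      have := (tendsto_pow_atTop_nhds_zero_of_lt_one (inv_nonneg.2 hr0.le)
        (inv_lt_one_of_one_lt₀ hr)).smul_const x
      simpa using this
    obtain ⟨m, hm⟩ := (ht.eventually hU).exists
    rw [← hS0] at hm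
    have h1 := hexp 0 m _ hm
    rw [smul_smul, ← mul_pow, mul_inv_cancel₀ hr0.ne', one_pow, one_smul] at h1
    exact ⟨_, h1⟩

end IsUnitEllipsoid

theorem mem_dilatedBalls {B : Set (Fin n → ℝ)} :
    B ∈ dilatedBalls A Δ ↔ ∃ x k, B = ballOf (ballAt A Δ) x k := by
  have : ∀ x k, (fun y => x + y) '' ballAt A Δ k = ballOf (ballAt A Δ) x k := by
    intro x k
    ext y
    simp [ballOf, sub_eq_neg_add]
  simp [dilatedBalls, this]

end Ellipsoid

end AnisoBMO

/-! ### Polynomials of bounded degree on a ball -/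

namespace AnisoBMO

open MeasureTheory Filter Topology
open scoped ENNReal Pointwise

section Polynomials

variable {𝕜 : Type*} [RCLike 𝕜] {n : ℕ}

theorem continuous_polyEval (P : MvPolynomial (Fin n) 𝕜) : Continuous (polyEval P) :=
  (MvPolynomial.continuous_eval P).comp
    (continuous_pi fun i => RCLike.continuous_ofReal.comp (continuous_apply i))

@[simp] theorem polyEval_add (P Q : MvPolynomial (Fin n) 𝕜) (x : Fin n → ℝ) :
    polyEval (P + Q) x = polyEval P x + polyEval Q x := by simp [polyEval]

@[simp] theorem polyEval_sub (P Q : MvPolynomial (Fin n) 𝕜) (x : Fin n → ℝ) :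
    polyEval (P - Q) x = polyEval P x - polyEval Q x := by simp [polyEval]

@[simp] theorem polyEval_smul (c : 𝕜) (P : MvPolynomial (Fin n) 𝕜) (x : Fin n → ℝ) :
    polyEval (c • P) x = c * polyEval P x := by simp [polyEval]

theorem polyEval_sum {ι : Type*} (T : Finset ι) (P : ι → MvPolynomial (Fin n) 𝕜)
    (x : Fin n → ℝ) : polyEval (∑ i ∈ T, P i) x = ∑ i ∈ T, polyEval (P i) x := by
  simp [polyEval]

theorem polyEval_map_conj (P : MvPolynomial (Fin n) 𝕜) (x : Fin n → ℝ) :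
    polyEval (MvPolynomial.map (starRingEnd 𝕜) P) x = starRingEnd 𝕜 (polyEval P x) := by
  have h := MvPolynomial.eval₂_comp_left (starRingEnd 𝕜) (RingHom.id 𝕜)
    (fun i => ((x i : ℝ) : 𝕜)) P
  simp only [polyEval, MvPolynomial.eval, MvPolynomial.coe_eval₂Hom, MvPolynomial.eval₂_map]
  rw [h]
  congr 1
  ext i; simp

/-- Composition of a polynomial with an affine map. -/
theorem exists_polyEval_affine (M : Matrix (Fin n) (Fin n) ℝ) (v : Fin n → ℝ)
    (P : MvPolynomial (Fin n) 𝕜) : ∃ P' : MvPolynomial (Fin n) 𝕜,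
      P'.totalDegree ≤ P.totalDegree ∧ ∀ w, polyEval P' w = polyEval P (v + M.mulVec w) := by
  set a : Fin n → MvPolynomial (Fin n) 𝕜 := fun i =>
    MvPolynomial.C ((v i : ℝ) : 𝕜) +
      ∑ j, MvPolynomial.C ((M i j : ℝ) : 𝕜) * MvPolynomial.X j with ha
  have hdeg : ∀ i, (a i).totalDegree ≤ 1 := by
    intro i
    refine (MvPolynomial.totalDegree_add _ _).trans (max_le (by simp) ?_)
    refine MvPolynomial.totalDegree_finsetSum_le fun j _ => ?_
    refine (MvPolynomial.totalDegree_mul _ _).trans ?_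
    simp
  refine ⟨MvPolynomial.bind₁ a P, ?_, fun w => ?_⟩
  · conv_lhs => rw [P.as_sum]
    rw [map_sum]
    refine MvPolynomial.totalDegree_finsetSum_le fun d hd => ?_
    rw [MvPolynomial.bind₁_monomial]
    refine (MvPolynomial.totalDegree_mul _ _).trans ?_
    rw [MvPolynomial.totalDegree_C, zero_add]
    refine (MvPolynomial.totalDegree_finsetProd _ _).trans ?_
    refine le_trans ?_ (MvPolynomial.le_totalDegree hd)
    refine Finset.sum_le_sum fun i _ => ?_
    refine (MvPolynomial.totalDegree_pow _ _).trans ?_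
    simpa using Nat.mul_le_mul_left (d i) (hdeg i)
  · unfold polyEval
    rw [← MvPolynomial.coe_aeval_eq_eval, RingHom.coe_coe, MvPolynomial.aeval_bind₁,
      ← MvPolynomial.coe_aeval_eq_eval, RingHom.coe_coe]
    congr 2
    ext i
    simp [ha, Matrix.mulVec, dotProduct]

/-- An open set contains a box, whose sides are infinite sets of scalars; real points therefore
suffice also for complex coefficients. -/
theorem eq_zero_of_polyEval_eq_zero {B : Set (Fin n → ℝ)} (hB : IsOpen B) (hne : B.Nonempty)
    {P : MvPolynomial (Fin n) 𝕜} (h : ∀ x ∈ B, polyEval P x = 0) : P = 0 := by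
  obtain ⟨x, hx⟩ := hne
  obtain ⟨ε, hε, hεB⟩ := Metric.isOpen_iff.1 hB x hx
  refine MvPolynomial.funext_set (fun i => (fun t : ℝ => (t : 𝕜)) '' Metric.ball (x i) ε)
    (fun i => ?_) fun y hy => ?_
  · refine Set.Infinite.image (RCLike.ofReal_injective.injOn) ?_
    rw [Real.ball_eq_Ioo]
    exact Set.Ioo_infinite (by linarith)
  · choose! t ht hty using fun i => hy i (Set.mem_univ i)
    have hy' : y = fun i => ((t i : ℝ) : 𝕜) := by ext i; exact (hty i).symm
    rw [map_zero, hy']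
    exact h t (hεB (by rw [ball_pi _ hε]; exact fun i _ => ht i))

theorem integrableOn_of_continuous {E : Type*} [NormedAddCommGroup E] {B : Set (Fin n → ℝ)}
    (hb : Bornology.IsBounded B) {g : (Fin n → ℝ) → E} (hg : Continuous g) : IntegrableOn g B :=
  (hg.locallyIntegrable.integrableOn_isCompact hb.isCompact_closure).mono_set subset_closure

theorem exists_bound_of_continuous {E : Type*} [NormedAddCommGroup E] {B : Set (Fin n → ℝ)}
    (hb : Bornology.IsBounded B) {g : (Fin n → ℝ) → E} (hg : Continuous g) :
    ∃ C, 0 ≤ C ∧ ∀ x ∈ B, ‖g x‖ ≤ C := by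
  obtain ⟨C, hC⟩ := hb.isCompact_closure.exists_bound_of_continuousOn hg.continuousOn
  exact ⟨max C 0, le_max_right _ _, fun x hx => (hC x (subset_closure hx)).trans (le_max_left _ _)⟩

theorem integrableOn_polyEval_mul {B : Set (Fin n → ℝ)} (hB : MeasurableSet B)
    (hb : Bornology.IsBounded B) (h : MvPolynomial (Fin n) 𝕜) {g : (Fin n → ℝ) → 𝕜}
    (hg : IntegrableOn g B) : IntegrableOn (fun x => polyEval h x * g x) B := by
  obtain ⟨C, -, hC⟩ := exists_bound_of_continuous hb (continuous_polyEval h)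
  exact hg.bdd_mul (c := C) (continuous_polyEval h).aestronglyMeasurable
    ((ae_restrict_iff' hB).2 (Eventually.of_forall hC))

/-- Every linear functional on polynomials of degree at most `s` is integration over `B` against
a polynomial of degree at most `s`. -/
theorem exists_poly_representation {B : Set (Fin n → ℝ)} (hB : IsOpen B) (hne : B.Nonempty)
    (hb : Bornology.IsBounded B) (s : ℕ)
    (l : MvPolynomial.restrictTotalDegree (Fin n) 𝕜 s →ₗ[𝕜] 𝕜) :
    ∃ P : MvPolynomial.restrictTotalDegree (Fin n) 𝕜 s,
      ∀ h, ∫ x in B, polyEval h.1 x * polyEval P.1 x = l h := by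
  have hint : ∀ P Q : MvPolynomial (Fin n) 𝕜,
      IntegrableOn (fun x => polyEval P x * polyEval Q x) B := fun P Q =>
    integrableOn_of_continuous hb ((continuous_polyEval P).mul (continuous_polyEval Q))
  let T : MvPolynomial.restrictTotalDegree (Fin n) 𝕜 s →ₗ[𝕜]
      Module.Dual 𝕜 (MvPolynomial.restrictTotalDegree (Fin n) 𝕜 s) :=
    LinearMap.mk₂ 𝕜 (fun P h => ∫ x in B, polyEval h.1 x * polyEval P.1 x)
      (fun P Q h => by
        simp only [Submodule.coe_add, polyEval_add, mul_add]
        exact integral_add (hint _ _) (hint _ _))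
      (fun c P h => by
        simp only [Submodule.coe_smul, polyEval_smul, smul_eq_mul, ← integral_const_mul]
        congr 1; ext x; ring)
      (fun P h h' => by
        simp only [Submodule.coe_add, polyEval_add, add_mul]
        exact integral_add (hint _ _) (hint _ _))
      (fun c P h => by
        simp only [Submodule.coe_smul, polyEval_smul, smul_eq_mul, ← integral_const_mul]
        congr 1; ext x; ring)
  -- The pairing is bilinear, as in the definition of `P_B^s`, so definiteness comes from testing
  -- against the conjugate polynomial, which gives `∫ |P|²`. Injectivity into a dual of equal finite
  -- dimension is then surjectivity.
  have hinj : Function.Injective T := by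
    rw [injective_iff_map_eq_zero]
    intro P hP
    have hPc : (MvPolynomial.map (starRingEnd 𝕜) P.1).totalDegree ≤ s :=
      (Finset.sup_mono (MvPolynomial.support_map_subset _ _)).trans
        ((MvPolynomial.mem_restrictTotalDegree _ _ _).1 P.2)
    have h1 : ∫ x in B, polyEval (MvPolynomial.map (starRingEnd 𝕜) P.1) x * polyEval P.1 x = 0 :=
      LinearMap.congr_fun hP ⟨_, (MvPolynomial.mem_restrictTotalDegree _ _ _).2 hPc⟩
    simp_rw [polyEval_map_conj, RCLike.conj_mul] at h1
    have h2 : ∫ x in B, ‖polyEval P.1 x‖ ^ 2 = 0 := by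
      have h3 : ∀ x, ((‖polyEval P.1 x‖ : 𝕜) ^ 2) = ((‖polyEval P.1 x‖ ^ 2 : ℝ) : 𝕜) := by
        intro x; push_cast; rfl
      simp_rw [h3] at h1
      rw [integral_ofReal] at h1
      exact_mod_cast h1
    have hcont : Continuous fun x => ‖polyEval P.1 x‖ ^ 2 := (continuous_polyEval P.1).norm.pow 2
    have h4 := (setIntegral_eq_zero_iff_of_nonneg_ae (Eventually.of_forall fun x => by positivity)
      (integrableOn_of_continuous hb hcont)).1 h2
    have h5 : Set.EqOn (fun x => ‖polyEval P.1 x‖ ^ 2) 0 B :=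
      Measure.eqOn_open_of_ae_eq h4 hB hcont.continuousOn continuousOn_const
    refine Subtype.ext (eq_zero_of_polyEval_eq_zero hB hne fun x hx => ?_)
    simpa using h5 hx
  have hsurj : Function.Surjective T :=
    (LinearMap.injective_iff_surjective_of_finrank_eq_finrank
      (Subspace.dual_finrank_eq (K := 𝕜)).symm).1 hinj
  obtain ⟨P, hP⟩ := hsurj l
  exact ⟨P, fun h => LinearMap.congr_fun hP h⟩

/-- The moments of `g` form a linear functional on polynomials of degree at most `s`, which some
polynomial represents. -/
theorem exists_isMinimizingPoly {B : Set (Fin n → ℝ)} (hB : IsOpen B) (hne : B.Nonempty)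
    (hb : Bornology.IsBounded B) (s : ℕ) {g : (Fin n → ℝ) → 𝕜} (hg : IntegrableOn g B) :
    ∃ P, IsMinimizingPoly B s g P := by
  have hint := fun P => integrableOn_polyEval_mul hB.measurableSet hb P hg
  let l : MvPolynomial.restrictTotalDegree (Fin n) 𝕜 s →ₗ[𝕜] 𝕜 :=
    { toFun := fun h => ∫ x in B, polyEval h.1 x * g x
      map_add' := fun h h' => by
        simp only [Submodule.coe_add, polyEval_add, add_mul]
        exact integral_add (hint _) (hint _)
      map_smul' := fun c h => by
        simp only [Submodule.coe_smul, polyEval_smul, smul_eq_mul, ← integral_const_mul,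
          RingHom.id_apply]
        congr 1; ext x; ring }
  obtain ⟨P, hP⟩ := exists_poly_representation hB hne hb s l
  refine ⟨P.1, (MvPolynomial.mem_restrictTotalDegree _ _ _).1 P.2, fun h hh => ?_⟩
  have h1 := hP ⟨h, (MvPolynomial.mem_restrictTotalDegree _ _ _).2 hh⟩
  simp_rw [mul_sub]
  have hint' : IntegrableOn (fun x => polyEval h x * polyEval P.1 x) B :=
    integrableOn_of_continuous hb ((continuous_polyEval h).mul (continuous_polyEval P.1))
  rw [integral_sub (hint h) hint']
  exact sub_eq_zero.2 h1.symm

theorem isMinimizingPoly_minimizingPoly {B : Set (Fin n → ℝ)} (hB : IsOpen B) (hne : B.Nonempty)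
    (hb : Bornology.IsBounded B) (s : ℕ) {g : (Fin n → ℝ) → 𝕜} (hg : IntegrableOn g B) :
    IsMinimizingPoly B s g (minimizingPoly B s g) := by
  have h := exists_isMinimizingPoly hB hne hb s hg
  rw [minimizingPoly, dif_pos h]
  exact h.choose_spec

/-- A polynomial is bounded on `B` by the `L¹` norm of any function with the same moments. -/
theorem exists_norm_polyEval_le {B : Set (Fin n → ℝ)} (hB : IsOpen B) (hne : B.Nonempty)
    (hb : Bornology.IsBounded B) (s : ℕ) : ∃ C : ℝ, 0 ≤ C ∧
      ∀ (R : MvPolynomial (Fin n) 𝕜) (u : (Fin n → ℝ) → 𝕜), R.totalDegree ≤ s →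
        IntegrableOn u B →
        (∀ h : MvPolynomial (Fin n) 𝕜, h.totalDegree ≤ s →
          ∫ x in B, polyEval h x * polyEval R x = ∫ x in B, polyEval h x * u x) →
        ∀ y ∈ B, ‖polyEval R y‖ ≤ C * ∫ x in B, ‖u x‖ := by
  -- Each coordinate in a fixed basis is integration against a fixed polynomial `H i`. Only the
  -- moments of `R` enter, and these are the moments of `u`.
  set e := Module.finBasis 𝕜 (MvPolynomial.restrictTotalDegree (Fin n) 𝕜 s) with he
  choose H hH using fun i => exists_poly_representation hB hne hb s (e.coord i)
  choose c hc0 hc using fun i => exists_bound_of_continuous hb (continuous_polyEval (H i).1)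
  choose c' hc0' hc' using fun i => exists_bound_of_continuous hb (continuous_polyEval (e i).1)
  refine ⟨∑ i, c i * c' i, Finset.sum_nonneg fun i _ => mul_nonneg (hc0 i) (hc0' i),
    fun R u hR hu hRu y hy => ?_⟩
  set R' : MvPolynomial.restrictTotalDegree (Fin n) 𝕜 s :=
    ⟨R, (MvPolynomial.mem_restrictTotalDegree _ _ _).2 hR⟩ with hR'
  have hcoord : ∀ i, ‖e.repr R' i‖ ≤ c i * ∫ x in B, ‖u x‖ := by
    intro i
    have h1 : e.repr R' i = ∫ x in B, polyEval (H i).1 x * u x := by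
      rw [← hRu (H i).1 ((MvPolynomial.mem_restrictTotalDegree _ _ _).1 (H i).2)]
      have := hH i R'
      rw [e.coord_apply] at this
      rw [← this]
      exact integral_congr_ae (Eventually.of_forall fun x => mul_comm _ _)
    rw [h1, ← integral_const_mul]
    refine norm_integral_le_of_norm_le (hu.norm.const_mul _) ?_
    refine (ae_restrict_iff' hB.measurableSet).2 (Eventually.of_forall fun x hx => ?_)
    rw [norm_mul]
    exact mul_le_mul_of_nonneg_right (hc i x hx) (norm_nonneg _)
  have hsum : polyEval R y = ∑ i, e.repr R' i * polyEval (e i).1 y := by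
    have h1 : R = ∑ i, e.repr R' i • (e i).1 := by
      have := congrArg Subtype.val (e.sum_repr R')
      rw [Submodule.coe_sum] at this
      exact this.symm
    conv_lhs => rw [h1, polyEval_sum]
    simp
  rw [hsum, Finset.sum_mul]
  refine norm_sum_le_of_le _ fun i _ => ?_
  rw [norm_mul]
  have hI : 0 ≤ ∫ x in B, ‖u x‖ := integral_nonneg fun x => norm_nonneg _
  calc ‖e.repr R' i‖ * ‖polyEval (e i).1 y‖ ≤ (c i * ∫ x in B, ‖u x‖) * c' i := by
        gcongr
        · exact mul_nonneg (hc0 i) hI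
        · exact hcoord i
        · exact hc' i y hy
    _ = _ := by ring

end Polynomials

/-! ### Transport from `Δ` to an arbitrary ball -/

section Affine

variable {𝕜 : Type*} [RCLike 𝕜] {n : ℕ} {A : Matrix (Fin n) (Fin n) ℝ} {Δ : Set (Fin n → ℝ)}

theorem ballOf_eq_image (x : Fin n → ℝ) (k : ℤ) :
    ballOf (ballAt A Δ) x k = (fun w => x + (A ^ k).mulVec w) '' Δ := by
  ext y
  simp [ballOf, ballAt, eq_sub_iff_add_eq']

theorem hasFDerivAt_affine (M : Matrix (Fin n) (Fin n) ℝ) (x w : Fin n → ℝ) :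
    HasFDerivAt (fun w => x + M.mulVec w) (LinearMap.toContinuousLinearMap (Matrix.toLin' M)) w :=
  (LinearMap.toContinuousLinearMap (Matrix.toLin' M)).hasFDerivAt.const_add x

theorem injective_affine (hA : IsUnit A.det) (x : Fin n → ℝ) (k : ℤ) :
    Function.Injective (fun w => x + (A ^ k).mulVec w) := by
  intro w w' h
  have h1 := congrArg (A ^ (-k)).mulVec (add_left_cancel h)
  simpa [Matrix.mulVec_mulVec, ← Matrix.zpow_add hA] using h1

variable {E : Type*} [NormedAddCommGroup E] [NormedSpace ℝ E]

theorem setIntegral_ballOf (hA : IsUnit A.det) (hΔ : MeasurableSet Δ) (x : Fin n → ℝ) (k : ℤ)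
    (F : (Fin n → ℝ) → E) : ∫ z in ballOf (ballAt A Δ) x k, F z =
      |A.det| ^ k • ∫ w in Δ, F (x + (A ^ k).mulVec w) := by
  rw [ballOf_eq_image, integral_image_eq_integral_abs_det_fderiv_smul volume hΔ
    (fun w _ => (hasFDerivAt_affine (A ^ k) x w).hasFDerivWithinAt) (injective_affine hA x k).injOn,
    ← integral_smul]
  simp [ContinuousLinearMap.det, det_zpow_eq, abs_zpow]

theorem integrableOn_comp_affine (hA : IsUnit A.det) (hΔ : MeasurableSet Δ) {x : Fin n → ℝ} {k : ℤ}
    {F : (Fin n → ℝ) → E} (hF : IntegrableOn F (ballOf (ballAt A Δ) x k)) :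
    IntegrableOn (fun w => F (x + (A ^ k).mulVec w)) Δ := by
  rw [ballOf_eq_image, integrableOn_image_iff_integrableOn_abs_det_fderiv_smul volume hΔ
    (fun w _ => (hasFDerivAt_affine (A ^ k) x w).hasFDerivWithinAt)
    (injective_affine hA x k).injOn] at hF
  have h0 : |A.det| ^ k ≠ 0 := zpow_ne_zero _ (abs_ne_zero.2 hA.ne_zero)
  have := hF.smul (|A.det| ^ k)⁻¹
  refine this.congr (Eventually.of_forall fun w => ?_)
  simp [ContinuousLinearMap.det, det_zpow_eq, abs_zpow, smul_smul, h0]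

/-- Scale invariant form of `exists_norm_polyEval_le`. -/
theorem exists_norm_polyEval_ballOf_le (h : IsUnitEllipsoid A Δ) (s : ℕ) : ∃ C : ℝ, 0 ≤ C ∧
    ∀ (x : Fin n → ℝ) (k : ℤ) (R : MvPolynomial (Fin n) 𝕜) (u : (Fin n → ℝ) → 𝕜),
      R.totalDegree ≤ s → IntegrableOn u (ballOf (ballAt A Δ) x k) →
      (∀ q : MvPolynomial (Fin n) 𝕜, q.totalDegree ≤ s →
        ∫ z in ballOf (ballAt A Δ) x k, polyEval q z * polyEval R z =
          ∫ z in ballOf (ballAt A Δ) x k, polyEval q z * u z) →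
      ∀ y ∈ ballOf (ballAt A Δ) x k, ‖polyEval R y‖ₑ * ENNReal.ofReal (|A.det| ^ k) ≤
        ENNReal.ofReal C * ∫⁻ z in ballOf (ballAt A Δ) x k, ‖u z‖ₑ := by
  have hA := h.isUnit_det
  have hm := h.isOpen.measurableSet
  have hb0 : ∀ k : ℤ, 0 < |A.det| ^ k := fun k => zpow_pos (abs_pos.2 hA.ne_zero) k
  obtain ⟨C, hC0, hC⟩ := exists_norm_polyEval_le (𝕜 := 𝕜) h.isOpen ⟨0, h.zero_mem⟩ h.isBounded s
  refine ⟨C, hC0, fun x k R u hR hu hRu y hy => ?_⟩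
  obtain ⟨R', hR'd, hR'⟩ := exists_polyEval_affine (A ^ k) x R
  have hbd := hC R' (fun w => u (x + (A ^ k).mulVec w)) (hR'd.trans hR)
    (integrableOn_comp_affine hA hm hu) (fun q hq => by
      -- Test polynomials on `Δ` are pulled back by the inverse affine map, which does not raise the
      -- degree; the Jacobian factor cancels from the two moments.
      obtain ⟨q', hq'd, hq'⟩ := exists_polyEval_affine (A ^ (-k)) (-(A ^ (-k)).mulVec x) q
      have h1 := hRu q' (hq'd.trans hq)
      rw [setIntegral_ballOf hA hm, setIntegral_ballOf hA hm] at h1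
      have h2 := smul_right_injective _ (hb0 k).ne' h1
      have h3 : ∀ w, polyEval q' (x + (A ^ k).mulVec w) = polyEval q w := fun w => by
        rw [hq']
        simp [Matrix.mulVec_add, Matrix.mulVec_mulVec, ← Matrix.zpow_add hA]
      simp_rw [h3] at h2
      simp_rw [hR']
      exact h2)
  rw [ballOf_eq_image] at hy
  obtain ⟨w, hw, rfl⟩ := hy
  have h4 := hbd w hw
  rw [hR'] at h4
  rw [← ofReal_integral_norm_eq_lintegral_enorm hu, ← ENNReal.ofReal_mul hC0, ← ofReal_norm,
    ← ENNReal.ofReal_mul (norm_nonneg _), setIntegral_ballOf hA hm, smul_eq_mul]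
  refine ENNReal.ofReal_le_ofReal ?_
  calc _ ≤ (C * ∫ w in Δ, ‖u (x + (A ^ k).mulVec w)‖) * |A.det| ^ k := by
        gcongr
    _ = _ := by ring

end Affine

end AnisoBMO

/-! ### The quasi-norm and log-Hölder exponents by scales -/

namespace AnisoBMO

open MeasureTheory Filter Topology
open scoped ENNReal Pointwise

section StepNorm

variable {n : ℕ} {A : Matrix (Fin n) (Fin n) ℝ} {Δ : Set (Fin n → ℝ)} {σ : ℕ}

theorem stepNorm_eq (h : BallScale (ballAt A Δ) |A.det| σ) {x : Fin n → ℝ} {k : ℤ}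
    (h1 : x ∈ ballAt A Δ (k + 1)) (h2 : x ∉ ballAt A Δ k) : stepNorm A Δ x = |A.det| ^ k := by
  rw [stepNorm, tsum_eq_single k, Set.indicator_of_mem (Set.mem_sdiff_of_mem h1 h2)]
  intro j hj
  refine Set.indicator_of_notMem (fun hx => ?_) _
  rcases lt_or_gt_of_ne hj with hlt | hgt
  · exact h2 (h.mono (show j + 1 ≤ k by omega) hx.1)
  · exact hx.2 (h.mono (show k + 1 ≤ j by omega) h1)

theorem exists_first_scale (h : BallScale (ballAt A Δ) |A.det| σ) {x : Fin n → ℝ} {k : ℤ}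
    (hx : x ∉ ballAt A Δ k) : ∃ j ≥ k, x ∈ ballAt A Δ (j + 1) ∧ x ∉ ballAt A Δ j := by
  obtain ⟨j, hj, hjm⟩ := Int.exists_least_of_bdd (P := fun j => x ∈ ballAt A Δ j)
    ⟨k, fun z hz => by
      by_contra hc
      exact hx (h.mono (not_le.1 hc).le hz)⟩ (h.exhaust x)
  have hkj : k < j := by
    by_contra hc
    exact hx (h.mono (not_lt.1 hc) hj)
  refine ⟨j - 1, by omega, by simpa using hj, fun hc => ?_⟩
  have := hjm _ hc
  omega

theorem le_stepNorm (h : BallScale (ballAt A Δ) |A.det| σ) {x : Fin n → ℝ} {k : ℤ}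
    (hx : x ∉ ballAt A Δ k) : |A.det| ^ k ≤ stepNorm A Δ x := by
  obtain ⟨j, hj, h1, h2⟩ := exists_first_scale h hx
  rw [stepNorm_eq h h1 h2]
  exact h.zpow_le hj

theorem eq_zero_of_forall_mem (h : BallScale (ballAt A Δ) |A.det| σ) {x : Fin n → ℝ}
    (hx : ∀ k, x ∈ ballAt A Δ k) : x = 0 := by
  by_contra hne
  obtain ⟨k, hk⟩ := h.small ‖x‖ (norm_pos_iff.2 hne)
  simpa using hk (hx k)

theorem exists_stepNorm_eq (h : BallScale (ballAt A Δ) |A.det| σ) {x : Fin n → ℝ} {k : ℤ}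
    (hx : x ∈ ballAt A Δ k) (hne : x ≠ 0) : ∃ j < k, stepNorm A Δ x = |A.det| ^ j := by
  have : ∃ i, x ∉ ballAt A Δ i := by
    by_contra hc
    exact hne (eq_zero_of_forall_mem h (not_exists_not.1 hc))
  obtain ⟨i, hi⟩ := this
  obtain ⟨j, -, h1, h2⟩ := exists_first_scale h hi
  refine ⟨j, ?_, stepNorm_eq h h1 h2⟩
  by_contra hc
  exact h2 (h.mono (not_lt.1 hc) hx)

end StepNorm

/-- Log-Hölder regularity of `p`, expressed in terms of the scales `S k`. -/
structure LogHolderScale {n : ℕ} (S : ℤ → Set (Fin n → ℝ)) (b : ℝ) (p : (Fin n → ℝ) → ℝ)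
    (pm q C₀ C₁ : ℝ) : Prop where
  pos : ∀ x, 0 < p x
  pm_pos : 0 < pm
  ae_mem : ∀ᵐ x, pm ≤ p x ∧ p x ≤ 1
  pm_le : pm ≤ q
  le_one : q ≤ 1
  C₀_pos : 0 < C₀
  C₁_pos : 0 < C₁
  near : ∀ x y i, x - y ∈ S i → |p x - p y| * max 1 (-i * Real.log b) ≤ C₀
  far : ∀ x i, x ∉ S i → |p x - q| * max 1 (i * Real.log b) ≤ C₁

/-- The logarithms in the hypotheses dominate both `1` and the logarithm of the relevant power of
`b`, which produces the `max`. The limit exponent inherits the bounds `p₋` and `1` because `p`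
approaches it far from the origin. -/
theorem exists_logHolderScale {n : ℕ} {A : Matrix (Fin n) (Fin n) ℝ} {Δ : Set (Fin n → ℝ)}
    {σ : ℕ} (h : BallScale (ballAt A Δ) |A.det| σ) {p : (Fin n → ℝ) → ℝ}
    (hp : IsLogHolder A Δ p) (hp1 : pPlus p ≤ 1) :
    ∃ pm q C₀ C₁, LogHolderScale (ballAt A Δ) |A.det| p pm q C₀ C₁ := by
  obtain ⟨⟨hmeas, hpos, hpm, M, hM⟩, C₀, C₁, q, hC₀, hC₁, hnear, hfar⟩ := hp
  have hlogb : 0 < Real.log |A.det| := Real.log_pos h.one_lt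
  have hlower : ∀ᵐ x, pMinus p ≤ p x :=
    ae_essInf_le (isBoundedUnder_of ⟨0, fun x => (hpos x).le⟩)
  have hupper : ∀ᵐ x, p x ≤ pPlus p := ae_le_essSup ⟨M, hM⟩
  have hae : ∀ᵐ x, pMinus p ≤ p x ∧ p x ≤ 1 := by
    filter_upwards [hlower, hupper] with x h1 h2 using ⟨h1, h2.trans hp1⟩
  have hfar' : ∀ x i, x ∉ ballAt A Δ i → |p x - q| * max 1 (i * Real.log |A.det|) ≤ C₁ := by
    intro x i hx
    have h1 : max 1 (i * Real.log |A.det|) ≤ Real.log (Real.exp 1 + stepNorm A Δ x) := by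
      have h2 := le_stepNorm h hx
      have h3 := h.zpow_pos i
      refine max_le ?_ ?_
      · rw [Real.le_log_iff_exp_le (by linarith [Real.exp_pos 1])]
        linarith
      · rw [← Real.log_zpow]
        exact Real.log_le_log h3 (by linarith [Real.exp_pos 1])
    have h4 : 0 < Real.log (Real.exp 1 + stepNorm A Δ x) :=
      zero_lt_one.trans_le ((le_max_left _ _).trans h1)
    calc _ ≤ |p x - q| * Real.log (Real.exp 1 + stepNorm A Δ x) := by gcongr
      _ ≤ C₁ := (le_div_iff₀ h4).1 (hfar x)
  have happrox : ∀ ε > 0, ∃ x, (pMinus p ≤ p x ∧ p x ≤ 1) ∧ |p x - q| ≤ ε := by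
    intro ε hε
    obtain ⟨i, hi⟩ := exists_nat_gt (C₁ / ε / Real.log |A.det|)
    -- The almost everywhere bounds must hold at some point outside `B_i`; otherwise `B_(i+1)` would
    -- be almost contained in `B_i`.
    have hex : ∃ x, (pMinus p ≤ p x ∧ p x ≤ 1) ∧ x ∉ ballAt A Δ i := by
      by_contra hc
      push Not at hc
      have h1 : volume (ballAt A Δ (i + 1)) ≤ volume (ballAt A Δ i) :=
        measure_mono_ae (by filter_upwards [hae] with x hx _ using hc x hx)
      rw [h.volume_eq, h.volume_eq, ENNReal.ofReal_le_ofReal_iff (h.zpow_pos _).le,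
        zpow_le_zpow_iff_right₀ h.one_lt] at h1
      omega
    obtain ⟨x, hx, hxi⟩ := hex
    refine ⟨x, hx, ?_⟩
    have h2 := hfar' x i hxi
    have h3 : C₁ / ε < i * Real.log |A.det| := (div_lt_iff₀ hlogb).1 hi
    rw [div_lt_iff₀ hε] at h3
    have h4 : |p x - q| * (i * Real.log |A.det|) ≤ C₁ := by
      refine le_trans ?_ h2
      gcongr
      exact_mod_cast le_max_right _ _
    have h5 : 0 < i * Real.log |A.det| := by
      by_contra hc
      nlinarith
    by_contra hc
    nlinarith [not_le.1 hc]
  refine ⟨pMinus p, q, C₀, C₁, hpos, hpm, hae, ?_, ?_, hC₀, hC₁, ?_, hfar'⟩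
  · refine le_of_forall_pos_le_add fun ε hε => ?_
    obtain ⟨x, hx, hxq⟩ := happrox ε hε
    linarith [(abs_le.1 hxq).2]
  · refine le_of_forall_pos_le_add fun ε hε => ?_
    obtain ⟨x, hx, hxq⟩ := happrox ε hε
    linarith [(abs_le.1 hxq).1]
  · intro x y i hxy
    rcases eq_or_ne x y with rfl | hne
    · simpa using hC₀.le
    obtain ⟨j, hj, hjeq⟩ := exists_stepNorm_eq h hxy (sub_ne_zero.2 hne)
    have h0 := hnear x y
    rw [hjeq, one_div, ← zpow_neg] at h0
    have h1 : max 1 (-i * Real.log |A.det|) ≤ Real.log (Real.exp 1 + |A.det| ^ (-j)) := by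
      have h3 := h.zpow_pos (-j)
      refine max_le ?_ ?_
      · rw [Real.le_log_iff_exp_le (by positivity)]
        linarith
      · have h4 : (-i : ℝ) * Real.log |A.det| = Real.log (|A.det| ^ (-i)) := by
          rw [Real.log_zpow]; push_cast; rfl
        rw [h4]
        exact Real.log_le_log (h.zpow_pos _)
          (by linarith [Real.exp_pos 1, h.zpow_le (show -i ≤ -j by omega)])
    have h4 : 0 < Real.log (Real.exp 1 + |A.det| ^ (-j)) :=
      zero_lt_one.trans_le ((le_max_left _ _).trans h1)
    calc _ ≤ |p x - p y| * Real.log (Real.exp 1 + |A.det| ^ (-j)) := by gcongr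
      _ ≤ C₀ := (le_div_iff₀ h4).1 h0

/-! ### Norms of characteristic functions -/

section CharacteristicNorm

variable {n : ℕ} {p : (Fin n → ℝ) → ℝ}

theorem modular_indicator (hpos : ∀ x, 0 < p x) {B : Set (Fin n → ℝ)} (hB : MeasurableSet B)
    {t : ℝ} (ht : 0 < t) : modular p (fun x => B.indicator (fun _ => (1 : ℝ)) x / t) =
      ∫⁻ x in B, ENNReal.ofReal (t⁻¹ ^ p x) := by
  rw [modular, ← lintegral_indicator hB]
  refine lintegral_congr fun x => ?_
  by_cases hx : x ∈ B
  · simp [hx, abs_of_pos ht]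
  · simp [hx, Real.zero_rpow (hpos x).ne']

theorem chiNorm_le (hpos : ∀ x, 0 < p x) {B : Set (Fin n → ℝ)} (hB : MeasurableSet B) {t : ℝ}
    (ht : 0 < t) (h : ∫⁻ x in B, ENNReal.ofReal (t⁻¹ ^ p x) ≤ 1) : chiNorm p B ≤ t :=
  csInf_le ⟨0, fun _ hs => hs.1.le⟩ ⟨ht, (modular_indicator hpos hB ht).trans_le h⟩

namespace LogHolderScale

variable {S : ℤ → Set (Fin n → ℝ)} {b : ℝ} {σ : ℕ} {pm q C₀ C₁ : ℝ}

theorem q_pos (H : LogHolderScale S b p pm q C₀ C₁) : 0 < q := H.pm_pos.trans_le H.pm_le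

theorem le_lintegral (h : BallScale S b σ) {x : Fin n → ℝ} {k : ℤ} {c : ℝ} (hc : 0 ≤ c)
    {F : (Fin n → ℝ) → ℝ} (hF : ∀ᵐ y, y ∈ ballOf S x k → c ≤ F y)
    (hle : ∫⁻ y in ballOf S x k, ENNReal.ofReal (F y) ≤ 1) : c * b ^ k ≤ 1 := by
  have h1 : ENNReal.ofReal c * volume (ballOf S x k) ≤ 1 := by
    rw [← setLIntegral_const]
    refine le_trans (setLIntegral_mono_ae' (h.measurableSet_ballOf x k) ?_) hle
    filter_upwards [hF] with y hy hyB using ENNReal.ofReal_le_ofReal (hy hyB)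
  rw [h.volume_ballOf, ← ENNReal.ofReal_mul hc] at h1
  exact ENNReal.ofReal_le_one.1 h1

theorem lintegral_le (h : BallScale S b σ) {x : Fin n → ℝ} {k : ℤ} {c : ℝ} (hc : 0 ≤ c)
    {F : (Fin n → ℝ) → ℝ} (hF : ∀ᵐ y, y ∈ ballOf S x k → F y ≤ c) (hle : c * b ^ k ≤ 1) :
    ∫⁻ y in ballOf S x k, ENNReal.ofReal (F y) ≤ 1 := by
  calc ∫⁻ y in ballOf S x k, ENNReal.ofReal (F y)
      ≤ ∫⁻ y in ballOf S x k, ENNReal.ofReal c := by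
        refine setLIntegral_mono_ae' (h.measurableSet_ballOf x k) ?_
        filter_upwards [hF] with y hy hyB using ENNReal.ofReal_le_ofReal (hy hyB)
    _ = ENNReal.ofReal (c * b ^ k) := by
        rw [setLIntegral_const, h.volume_ballOf, ENNReal.ofReal_mul hc]
    _ ≤ 1 := ENNReal.ofReal_le_one.2 hle

/-- The infimum of the empty set of reals is `0`, so lower bounds on `chiNorm` need an admissible
`t`. -/
theorem exists_admissible (H : LogHolderScale S b p pm q C₀ C₁) (h : BallScale S b σ)
    (x : Fin n → ℝ) (k : ℤ) :
    ∃ t : ℝ, 0 < t ∧ ∫⁻ y in ballOf S x k, ENNReal.ofReal (t⁻¹ ^ p y) ≤ 1 := by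
  have hV := h.zpow_pos k
  set t : ℝ := max 1 ((b ^ k) ^ pm⁻¹) with ht
  have ht1 : 1 ≤ t := le_max_left _ _
  have ht0 : 0 < t := by linarith
  refine ⟨t, ht0, lintegral_le h (c := t⁻¹ ^ pm) (by positivity) ?_ ?_⟩
  · filter_upwards [H.ae_mem] with y hy _
    exact Real.rpow_le_rpow_of_exponent_ge (by positivity) (inv_le_one_of_one_le₀ ht1) hy.1
  · rw [Real.inv_rpow ht0.le, inv_mul_le_iff₀ (by positivity), mul_one]
    calc b ^ k = ((b ^ k) ^ pm⁻¹) ^ pm := by rw [Real.rpow_inv_rpow hV.le H.pm_pos.ne']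
      _ ≤ t ^ pm := Real.rpow_le_rpow (by positivity) (le_max_right _ _) H.pm_pos.le

theorem le_chiNorm (H : LogHolderScale S b p pm q C₀ C₁) (h : BallScale S b σ)
    {x : Fin n → ℝ} {k : ℤ} {c : ℝ} (hc : ∀ t : ℝ, 0 < t →
      ∫⁻ y in ballOf S x k, ENNReal.ofReal (t⁻¹ ^ p y) ≤ 1 → c ≤ t) :
    c ≤ chiNorm p (ballOf S x k) := by
  have hmod := fun t (ht : (0 : ℝ) < t) =>
    modular_indicator H.pos (h.measurableSet_ballOf x k) ht
  refine le_csInf ?_ fun t ht => hc t ht.1 ((hmod t ht.1).symm.trans_le ht.2)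
  obtain ⟨t, ht, hle⟩ := H.exists_admissible h x k
  exact ⟨t, ht, (hmod t ht).trans_le hle⟩

theorem rpow_mul_le_one (H : LogHolderScale S b p pm q C₀ C₁) (h : BallScale S b σ)
    {x : Fin n → ℝ} {k : ℤ} {t : ℝ} (ht : 0 < t) (ht1 : t ≤ 1)
    (hle : ∫⁻ y in ballOf S x k, ENNReal.ofReal (t⁻¹ ^ p y) ≤ 1) : t⁻¹ ^ pm * b ^ k ≤ 1 := by
  refine le_lintegral h (by positivity) ?_ hle
  filter_upwards [H.ae_mem] with y hy _
  exact Real.rpow_le_rpow_of_exponent_le ((one_le_inv₀ ht).2 ht1) hy.1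

theorem chiNorm_pos (H : LogHolderScale S b p pm q C₀ C₁) (h : BallScale S b σ)
    (x : Fin n → ℝ) (k : ℤ) : 0 < chiNorm p (ballOf S x k) := by
  have hV := h.zpow_pos k
  refine (show 0 < min 1 ((b ^ k) ^ pm⁻¹) by positivity).trans_le
    (H.le_chiNorm h fun t ht hle => ?_)
  rcases le_or_gt t 1 with ht1 | ht1
  · have h1 := H.rpow_mul_le_one h ht ht1 hle
    rw [Real.inv_rpow ht.le, inv_mul_le_iff₀ (by positivity), mul_one] at h1
    refine (min_le_right _ _).trans ?_
    calc (b ^ k) ^ pm⁻¹ ≤ (t ^ pm) ^ pm⁻¹ :=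
          Real.rpow_le_rpow hV.le h1 (inv_nonneg.2 H.pm_pos.le)
      _ = t := Real.rpow_rpow_inv ht.le H.pm_pos.ne'
  · exact (min_le_left _ _).trans ht1.le

/-- For `t ≥ 1`, `p ≤ 1` gives `t⁻¹ ^ p ≥ t⁻¹`, hence `|B| / t ≤ 1`. A `t < 1` would push the
modular above `|B| ≥ 1`. -/
theorem zpow_le_of_admissible (H : LogHolderScale S b p pm q C₀ C₁) (h : BallScale S b σ)
    {x : Fin n → ℝ} {k : ℤ} (hk : 0 ≤ k) {t : ℝ} (ht : 0 < t)
    (hle : ∫⁻ y in ballOf S x k, ENNReal.ofReal (t⁻¹ ^ p y) ≤ 1) : b ^ k ≤ t := by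
  have hV : 1 ≤ b ^ k := one_le_zpow₀ h.one_lt.le hk
  rcases le_or_gt 1 t with ht1 | ht1
  · have h1 : t⁻¹ * b ^ k ≤ 1 := by
      refine le_lintegral h (by positivity) ?_ hle
      filter_upwards [H.ae_mem] with y hy _
      simpa using Real.rpow_le_rpow_of_exponent_ge (inv_pos.2 ht) (inv_le_one_of_one_le₀ ht1) hy.2
    rwa [inv_mul_le_iff₀ ht, mul_one] at h1
  · have h1 := H.rpow_mul_le_one h ht ht1.le hle
    have h2 : 1 < t⁻¹ ^ pm := Real.one_lt_rpow ((one_lt_inv₀ ht).2 ht1) H.pm_pos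
    nlinarith

theorem zpow_le_chiNorm (H : LogHolderScale S b p pm q C₀ C₁) (h : BallScale S b σ)
    (x : Fin n → ℝ) {k : ℤ} (hk : 0 ≤ k) : b ^ k ≤ chiNorm p (ballOf S x k) :=
  H.le_chiNorm h fun _ ht hle => H.zpow_le_of_admissible h hk ht hle

theorem chiNorm_le_zpow (H : LogHolderScale S b p pm q C₀ C₁) (h : BallScale S b σ)
    (x : Fin n → ℝ) {k : ℤ} (hk : k ≤ 0) : chiNorm p (ballOf S x k) ≤ b ^ k := by
  have hV := h.zpow_pos k
  have hV1 : b ^ k ≤ 1 := zpow_le_one_of_nonpos₀ h.one_lt.le hk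
  refine chiNorm_le H.pos (h.measurableSet_ballOf x k) hV
    (lintegral_le h (c := (b ^ k)⁻¹) (by positivity) ?_ (inv_mul_cancel₀ hV.ne').le)
  filter_upwards [H.ae_mem] with y hy _
  simpa using Real.rpow_le_rpow_of_exponent_le ((one_le_inv₀ hV).2 hV1) hy.2

theorem rpow_le_exp_mul_rpow {t u v D : ℝ} (ht : 0 < t) (h : Real.log t * (u - v) ≤ D) :
    t ^ u ≤ Real.exp D * t ^ v := by
  rw [Real.rpow_def_of_pos ht, Real.rpow_def_of_pos ht, ← Real.exp_add]
  exact Real.exp_le_exp.2 (by linarith)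

/-- Comparison of `‖χ_{B'}‖` with `‖χ_B‖` when `B` has measure at most one. -/
theorem exists_chiNorm_le_of_nonpos (H : LogHolderScale S b p pm q C₀ C₁) (h : BallScale S b σ) :
    ∃ C : ℝ, 0 < C ∧ ∀ (x x' : Fin n → ℝ) (k k' : ℤ), k ≤ 0 → k' ≤ k + σ →
      ballOf S x' k' ⊆ ballOf S x (k + σ) →
      chiNorm p (ballOf S x' k') ≤ C * b ^ (k' - k) * chiNorm p (ballOf S x k) := by
  have hlogb : 0 < Real.log b := Real.log_pos h.one_lt
  have hpm := H.pm_pos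
  set D : ℝ := C₀ / pm * (1 + 2 * σ * Real.log b) with hD
  -- `G⁻¹ ^ pm` cancels exactly two losses: `exp D` from the oscillation of `p` over the balls, and
  -- `b ^ σ` from `|B'| = θ b ^ σ |B|`.
  set G : ℝ := (b ^ (σ : ℤ) * Real.exp D) ^ pm⁻¹ with hG
  have hbσ := h.zpow_pos σ
  have hDpos : 0 ≤ D := by have := H.C₀_pos; positivity
  have hGpos : 0 < G := by positivity
  have hG1 : 1 ≤ G := by
    refine Real.one_le_rpow ?_ (inv_nonneg.2 hpm.le)
    have h1 : 1 ≤ b ^ (σ : ℤ) := one_le_zpow₀ h.one_lt.le (by positivity)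
    have h2 : 1 ≤ Real.exp D := Real.one_le_exp hDpos
    nlinarith
  refine ⟨G / b ^ (σ : ℤ), by positivity, fun x x' k k' hk hk' hsub => ?_⟩
  have hV := h.zpow_pos k
  have hV1 : b ^ k ≤ 1 := zpow_le_one_of_nonpos₀ h.one_lt.le hk
  set θ : ℝ := b ^ (k' - k - σ) with hθ
  have hθpos : 0 < θ := h.zpow_pos _
  have hθ1 : θ ≤ 1 := zpow_le_one_of_nonpos₀ h.one_lt.le (by omega)
  have hθeq : G / b ^ (σ : ℤ) * b ^ (k' - k) = G * θ := by
    rw [hθ, zpow_sub₀ h.b_pos.ne' (k' - k)]; ring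
  rw [hθeq]
  -- If `t ≤ 1` is admissible for `B`, then `G θ t` is admissible for `B'`. Admissibility bounds
  -- `log t⁻¹` by a multiple of `-k log b`, which the local log-Hölder estimate absorbs; `p ≤ 1`
  -- gives `θ⁻¹ ^ p ≤ θ⁻¹`.
  have main : ∀ t : ℝ, 0 < t → t ≤ 1 →
      ∫⁻ y in ballOf S x k, ENNReal.ofReal (t⁻¹ ^ p y) ≤ 1 →
      chiNorm p (ballOf S x' k') ≤ G * θ * t := by
    intro t ht ht1 hle
    have hlogt : Real.log t⁻¹ ≤ -k * Real.log b / pm := by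
      have h1 := H.rpow_mul_le_one h ht ht1 hle
      have h2 := Real.log_nonpos (by positivity) h1
      rw [Real.log_mul (by positivity) hV.ne', Real.log_rpow (by positivity), Real.log_zpow] at h2
      rw [le_div_iff₀ hpm]
      linarith
    have hlogt0 : 0 ≤ Real.log t⁻¹ := Real.log_nonneg ((one_le_inv₀ ht).2 ht1)
    have hcomp : ∀ y ∈ ballOf S x' k', ∀ z ∈ ballOf S x k,
        t⁻¹ ^ p y ≤ Real.exp D * t⁻¹ ^ p z := by
      intro y hy z hz
      refine rpow_le_exp_mul_rpow (by positivity) ?_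
      have hyz : y - z ∈ S (k + σ + σ) := by
        have h1 := h.add_mem _ _ _ (hsub hy) (h.neg_mem _ _ (h.mono (by omega) hz))
        simpa using h1
      have h2 := H.near y z _ hyz
      set X : ℝ := max 1 (-(k + σ + σ : ℤ) * Real.log b) with hX
      have hX1 : 1 ≤ X := le_max_left _ _
      have hX2 : -(k + σ + σ : ℤ) * Real.log b ≤ X := le_max_right _ _
      have h3 : -k * Real.log b ≤ X * (1 + 2 * σ * Real.log b) := by
        push_cast at hX2
        have : 2 * σ * Real.log b ≤ X * (2 * σ * Real.log b) :=
          le_mul_of_one_le_left (by positivity) hX1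
        linarith
      calc Real.log t⁻¹ * (p y - p z) ≤ Real.log t⁻¹ * |p y - p z| := by
            gcongr; exact le_abs_self _
        _ ≤ (X * (1 + 2 * σ * Real.log b) / pm) * |p y - p z| := by
            gcongr; exact hlogt.trans (by gcongr)
        _ = (|p y - p z| * X) * ((1 + 2 * σ * Real.log b) / pm) := by ring
        _ ≤ C₀ * ((1 + 2 * σ * Real.log b) / pm) := by gcongr
        _ = D := by rw [hD]; ring
    have hpt : ∀ y ∈ ballOf S x' k', t⁻¹ ^ p y ≤ Real.exp D * (b ^ k)⁻¹ := by
      intro y hy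
      have h1 : (Real.exp D)⁻¹ * t⁻¹ ^ p y * b ^ k ≤ 1 := by
        refine le_lintegral h (by positivity) (Eventually.of_forall fun z hz => ?_) hle
        rw [inv_mul_le_iff₀ (Real.exp_pos D)]
        exact hcomp y hy z hz
      rw [mul_assoc, inv_mul_le_iff₀ (Real.exp_pos D), mul_one] at h1
      rwa [← div_eq_mul_inv, le_div_iff₀ hV]
    refine chiNorm_le H.pos (h.measurableSet_ballOf _ _) (by positivity) (lintegral_le h
      (c := G⁻¹ ^ pm * θ⁻¹ * (Real.exp D * (b ^ k)⁻¹)) (by positivity) ?_ ?_)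
    · filter_upwards [H.ae_mem] with y hy hyB
      rw [mul_inv, mul_inv, Real.mul_rpow (by positivity) (by positivity),
        Real.mul_rpow (by positivity) (by positivity)]
      have e1 : G⁻¹ ^ p y ≤ G⁻¹ ^ pm :=
        Real.rpow_le_rpow_of_exponent_ge (by positivity) (inv_le_one_of_one_le₀ hG1) hy.1
      have e2 : θ⁻¹ ^ p y ≤ θ⁻¹ := by
        simpa using Real.rpow_le_rpow_of_exponent_le ((one_le_inv₀ hθpos).2 hθ1) hy.2
      exact mul_le_mul (mul_le_mul e1 e2 (by positivity) (by positivity)) (hpt y hyB)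
        (by positivity) (by positivity)
    · have h1 : G⁻¹ ^ pm = (b ^ (σ : ℤ) * Real.exp D)⁻¹ := by
        rw [Real.inv_rpow hGpos.le, hG, Real.rpow_inv_rpow (by positivity) hpm.ne']
      have h2 : b ^ k' = θ * (b ^ k * b ^ (σ : ℤ)) := by
        rw [hθ, ← zpow_add₀ h.b_pos.ne', ← zpow_add₀ h.b_pos.ne']
        congr 1; ring
      rw [h1, h2]
      have := Real.exp_pos D
      refine le_of_eq ?_
      field_simp
  have hGθ : 0 < G * θ := by positivity
  rw [← div_le_iff₀' hGθ]
  refine H.le_chiNorm h fun t ht hle => ?_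
  rw [div_le_iff₀' hGθ]
  rcases le_or_gt t 1 with ht1 | ht1
  · exact main t ht ht1 hle
  -- Since `|B| ≤ 1`, the value `1` is itself admissible, which covers `t > 1`.
  · refine (main 1 one_pos le_rfl (lintegral_le h (c := 1) zero_le_one ?_ (by linarith))).trans ?_
    · exact Eventually.of_forall fun y _ => by simp
    · gcongr

/-- Upper bound for `‖χ_B‖` at scales at least one. -/
theorem exists_chiNorm_le_rpow (H : LogHolderScale S b p pm q C₀ C₁) (h : BallScale S b σ) :
    ∃ C : ℝ, 0 < C ∧ ∀ (x : Fin n → ℝ) (k : ℤ), 0 ≤ k →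
      chiNorm p (ballOf S x k) ≤ C * (b ^ k) ^ q⁻¹ := by
  have hlogb : 0 < Real.log b := Real.log_pos h.one_lt
  have hpm := H.pm_pos
  have hq := H.q_pos
  set D : ℝ := C₁ * (1 + Real.log b) / pm with hD
  set G : ℝ := (1 + Real.exp D) ^ pm⁻¹ with hG
  have hGpos : 0 < G := by positivity
  have hG1 : 1 ≤ G := Real.one_le_rpow (by linarith [Real.exp_pos D]) (inv_nonneg.2 hpm.le)
  have hGpm : G⁻¹ ^ pm = (1 + Real.exp D)⁻¹ := by
    rw [Real.inv_rpow hGpos.le, hG, Real.rpow_inv_rpow (by positivity) hpm.ne']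
  refine ⟨G, hGpos, fun x k hk => ?_⟩
  have hV := h.zpow_pos k
  have hV1 : 1 ≤ b ^ k := one_le_zpow₀ h.one_lt.le hk
  set s : ℝ := (b ^ k) ^ q⁻¹ with hs
  have hs1 : 1 ≤ s := Real.one_le_rpow hV1 (inv_nonneg.2 hq.le)
  have hs0 : 0 < s := by linarith
  have hlogs : Real.log s = k * Real.log b / q := by
    rw [hs, Real.log_rpow hV, Real.log_zpow]; ring
  -- The cut-off is small enough that `S j` costs at most `s ^ pm` in measure, matching the crude
  -- bound `s⁻¹ ^ pm` there. It is large enough that `log s` is controlled by `j log b`, so decay at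
  -- infinity replaces `p` by `q` outside `S j`.
  set j : ℤ := ⌊k * (pm / q)⌋ with hj
  have hj1 : (j : ℝ) ≤ k * (pm / q) := Int.floor_le _
  have hj2 : k * (pm / q) < j + 1 := Int.lt_floor_add_one _
  have hspm : s ^ pm = (b ^ k) ^ (pm / q) := by
    rw [hs, ← Real.rpow_mul hV.le]; congr 1; ring
  have hbj : b ^ j ≤ s ^ pm := by
    rw [hspm, ← Real.rpow_intCast, ← Real.rpow_intCast, ← Real.rpow_mul h.b_pos.le]
    exact Real.rpow_le_rpow_of_exponent_le h.one_lt.le hj1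
  have hfar : ∀ y, y ∉ S j → s⁻¹ ^ p y ≤ Real.exp D * (b ^ k)⁻¹ := by
    intro y hy
    have h1 : s⁻¹ ^ q = (b ^ k)⁻¹ := by
      rw [Real.inv_rpow hs0.le, hs, Real.rpow_inv_rpow hV.le hq.ne']
    rw [← h1]
    refine rpow_le_exp_mul_rpow (by positivity) ?_
    have h2 := H.far y j hy
    set X : ℝ := max 1 (j * Real.log b) with hX
    have hX1 : 1 ≤ X := le_max_left _ _
    have hX2 : j * Real.log b ≤ X := le_max_right _ _
    have h3 : Real.log s ≤ X * (1 + Real.log b) / pm := by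
      rw [hlogs, le_div_iff₀ hpm]
      calc k * Real.log b / q * pm = k * (pm / q) * Real.log b := by ring
        _ ≤ (j + 1) * Real.log b := by gcongr
        _ ≤ X * (1 + Real.log b) := by nlinarith
    have h4 : 0 ≤ Real.log s := Real.log_nonneg hs1
    rw [Real.log_inv]
    calc -Real.log s * (p y - q) = Real.log s * (q - p y) := by ring
      _ ≤ Real.log s * |p y - q| := by
          gcongr; rw [abs_sub_comm]; exact le_abs_self _
      _ ≤ (X * (1 + Real.log b) / pm) * |p y - q| := by gcongr
      _ = (|p y - q| * X) * ((1 + Real.log b) / pm) := by ring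
      _ ≤ C₁ * ((1 + Real.log b) / pm) := by gcongr
      _ = D := by rw [hD]; ring
  refine chiNorm_le H.pos (h.measurableSet_ballOf _ _) (by positivity) ?_
  set a : ℝ := (1 + Real.exp D)⁻¹ with ha
  have ha0 : 0 < a := by have := Real.exp_pos D; positivity
  calc ∫⁻ y in ballOf S x k, ENNReal.ofReal ((G * s)⁻¹ ^ p y)
      ≤ ∫⁻ y in ballOf S x k, ((S j).indicator (fun _ => ENNReal.ofReal (a * (s ^ pm)⁻¹)) y +
          ENNReal.ofReal (a * (Real.exp D * (b ^ k)⁻¹))) := by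
        refine lintegral_mono_ae (ae_restrict_of_ae ?_)
        filter_upwards [H.ae_mem] with y hy
        have h1 : G⁻¹ ^ p y ≤ a := by
          rw [← hGpm]
          exact Real.rpow_le_rpow_of_exponent_ge (by positivity) (inv_le_one_of_one_le₀ hG1) hy.1
        rw [mul_inv, Real.mul_rpow (by positivity) (by positivity)]
        by_cases hyS : y ∈ S j
        · rw [Set.indicator_of_mem hyS]
          refine le_add_right (ENNReal.ofReal_le_ofReal ?_)
          gcongr
          rw [← Real.inv_rpow hs0.le]
          exact Real.rpow_le_rpow_of_exponent_ge (by positivity) (inv_le_one_of_one_le₀ hs1) hy.1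
        · rw [Set.indicator_of_notMem hyS, zero_add]
          refine ENNReal.ofReal_le_ofReal ?_
          gcongr
          exact hfar y hyS
    _ ≤ ENNReal.ofReal (a * (s ^ pm)⁻¹) * ENNReal.ofReal (b ^ j) +
          ENNReal.ofReal (a * (Real.exp D * (b ^ k)⁻¹)) * ENNReal.ofReal (b ^ k) := by
        rw [lintegral_add_right _ measurable_const, setLIntegral_const, h.volume_ballOf]
        gcongr
        refine (setLIntegral_le_lintegral _ _).trans ?_
        rw [lintegral_indicator (h.isOpen j).measurableSet, setLIntegral_const, h.volume_eq]
    _ = ENNReal.ofReal (a * (s ^ pm)⁻¹ * b ^ j + a * (Real.exp D * (b ^ k)⁻¹) * b ^ k) := by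
        have := h.zpow_pos j
        rw [ENNReal.ofReal_add (by positivity) (by positivity), ENNReal.ofReal_mul (q := b ^ j) (by positivity),
          ENNReal.ofReal_mul (q := b ^ k) (by positivity)]
    _ ≤ 1 := by
        rw [ENNReal.ofReal_le_one]
        have h1 : (s ^ pm)⁻¹ * b ^ j ≤ 1 := by
          rw [inv_mul_le_iff₀ (by positivity), mul_one]; exact hbj
        have h2 : (b ^ k)⁻¹ * b ^ k = 1 := inv_mul_cancel₀ hV.ne'
        calc _ = a * ((s ^ pm)⁻¹ * b ^ j) + a * (Real.exp D * ((b ^ k)⁻¹ * b ^ k)) := by ring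
          _ ≤ a * 1 + a * (Real.exp D * 1) := by rw [h2]; gcongr
          _ = a * (1 + Real.exp D) := by ring
          _ = 1 := inv_mul_cancel₀ (by have := Real.exp_pos D; positivity)

/-- Lower bound for `‖χ_B‖` at scales at least one. -/
theorem exists_rpow_le_chiNorm (H : LogHolderScale S b p pm q C₀ C₁) (h : BallScale S b σ) :
    ∃ c : ℝ, 0 < c ∧ ∀ (x : Fin n → ℝ) (k : ℤ), 0 ≤ k →
      c * (b ^ k) ^ q⁻¹ ≤ chiNorm p (ballOf S x k) := by
  have hlogb : 0 < Real.log b := Real.log_pos h.one_lt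
  have hq := H.q_pos
  have hb1 : 0 < 1 - b⁻¹ := sub_pos.2 (inv_lt_one_of_one_lt₀ h.one_lt)
  set D : ℝ := C₁ * (1 + Real.log b) / q with hD
  have hD0 : 0 ≤ D := by have := H.C₁_pos; positivity
  -- Removing `S (k - 1)` leaves at least the fraction `1 - b⁻¹` of the ball, wherever its centre
  -- is; on the rest, replacing `p` by `q` costs `exp D`.
  set κ : ℝ := (Real.exp D)⁻¹ * (1 - b⁻¹) with hκ
  have hκ0 : 0 < κ := mul_pos (inv_pos.2 (Real.exp_pos D)) hb1
  have hκ1 : κ ≤ 1 := mul_le_one₀ (inv_le_one_of_one_le₀ (Real.one_le_exp hD0)) hb1.le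
    (by linarith [inv_pos.2 h.b_pos])
  refine ⟨κ ^ q⁻¹, by positivity, fun x k hk => H.le_chiNorm h fun t ht hle => ?_⟩
  have hV := h.zpow_pos k
  have hV1 : 1 ≤ b ^ k := one_le_zpow₀ h.one_lt.le hk
  have ht1 : 1 ≤ t := hV1.trans (H.zpow_le_of_admissible h hk ht hle)
  set s : ℝ := (b ^ k) ^ q⁻¹ with hs
  have hs0 : 0 < s := by positivity
  rcases le_or_gt s t with hst | hts
  · calc κ ^ q⁻¹ * s ≤ 1 * s := by
          gcongr; exact Real.rpow_le_one hκ0.le hκ1 (inv_nonneg.2 hq.le)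
      _ ≤ t := by rwa [one_mul]
  have hlogs : Real.log s = k * Real.log b / q := by
    rw [hs, Real.log_rpow hV, Real.log_zpow]; ring
  have hlogt : Real.log t ≤ k * Real.log b / q := hlogs ▸ Real.log_le_log ht hts.le
  have hlogt0 : 0 ≤ Real.log t := Real.log_nonneg ht1
  have hfar : ∀ y, y ∉ S (k - 1) → (Real.exp D)⁻¹ * t⁻¹ ^ q ≤ t⁻¹ ^ p y := by
    intro y hy
    rw [inv_mul_le_iff₀ (Real.exp_pos D)]
    refine rpow_le_exp_mul_rpow (by positivity) ?_
    have h2 := H.far y _ hy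
    set X : ℝ := max 1 ((k - 1 : ℤ) * Real.log b) with hX
    have hX1 : 1 ≤ X := le_max_left _ _
    have hX2 : (k - 1 : ℤ) * Real.log b ≤ X := le_max_right _ _
    have h3 : Real.log t ≤ X * (1 + Real.log b) / q := by
      refine hlogt.trans (div_le_div_of_nonneg_right ?_ hq.le)
      push_cast at hX2
      have : Real.log b ≤ X * Real.log b := le_mul_of_one_le_left hlogb.le hX1
      linarith
    rw [Real.log_inv]
    calc -Real.log t * (q - p y) = Real.log t * (p y - q) := by ring
      _ ≤ Real.log t * |p y - q| := by gcongr; exact le_abs_self _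
      _ ≤ (X * (1 + Real.log b) / q) * |p y - q| := by gcongr
      _ = (|p y - q| * X) * ((1 + Real.log b) / q) := by ring
      _ ≤ C₁ * ((1 + Real.log b) / q) := by gcongr
      _ = D := by rw [hD]; ring
  set c : ℝ := (Real.exp D)⁻¹ * t⁻¹ ^ q with hc
  have hc0 : 0 < c := by positivity
  have hmass : c * (b ^ k * (1 - b⁻¹)) ≤ 1 := by
    have h1 : ENNReal.ofReal c * volume (ballOf S x k \ S (k - 1)) ≤ 1 := by
      rw [← setLIntegral_const]
      refine le_trans (setLIntegral_mono' ((h.measurableSet_ballOf x k).diff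
        (h.isOpen _).measurableSet) fun y hy => ENNReal.ofReal_le_ofReal (hfar y hy.2)) ?_
      exact (lintegral_mono_set Set.sdiff_subset).trans hle
    have h2 : ENNReal.ofReal (b ^ k * (1 - b⁻¹)) ≤ volume (ballOf S x k \ S (k - 1)) := by
      have h3 : b ^ k * (1 - b⁻¹) = b ^ k - b ^ (k - 1) := by
        rw [zpow_sub_one₀ h.b_pos.ne']; ring
      rw [h3, ENNReal.ofReal_sub _ (h.zpow_pos _).le, ← h.volume_ballOf x k,
        ← h.volume_eq (k - 1)]
      exact le_measure_sdiff
    have h3 := (mul_le_mul_right h2 (ENNReal.ofReal c)).trans h1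
    rw [← ENNReal.ofReal_mul hc0.le] at h3
    exact ENNReal.ofReal_le_one.1 h3
  have hfin : κ * b ^ k ≤ t ^ q := by
    have h1 : c * (b ^ k * (1 - b⁻¹)) = (t ^ q)⁻¹ * (κ * b ^ k) := by
      rw [hc, hκ, Real.inv_rpow ht.le]; ring
    rwa [h1, inv_mul_le_iff₀ (by positivity), mul_one] at hmass
  calc κ ^ q⁻¹ * s = (κ * b ^ k) ^ q⁻¹ := by rw [Real.mul_rpow hκ0.le hV.le]
    _ ≤ (t ^ q) ^ q⁻¹ := Real.rpow_le_rpow (by positivity) hfin (inv_nonneg.2 hq.le)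
    _ = t := Real.rpow_rpow_inv ht.le hq.ne'

/-- For exponents at most one, `‖χ_B‖ / |B|` essentially increases with the ball. -/
theorem exists_chiNorm_le (H : LogHolderScale S b p pm q C₀ C₁) (h : BallScale S b σ) :
    ∃ C : ℝ, 0 < C ∧ ∀ (x x' : Fin n → ℝ) (k k' : ℤ),
      ballOf S x' k' ⊆ ballOf S x (k + σ) →
      chiNorm p (ballOf S x' k') ≤ C * b ^ (k' - k) * chiNorm p (ballOf S x k) := by
  obtain ⟨C, hC, hsmall⟩ := H.exists_chiNorm_le_of_nonpos h
  obtain ⟨D, hD, hup⟩ := H.exists_chiNorm_le_rpow h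
  obtain ⟨c, hc, hlow⟩ := H.exists_rpow_le_chiNorm h
  have hq := H.q_pos
  have hbσ := h.zpow_pos σ
  set M : ℝ := D / c * (b ^ (σ : ℤ)) ^ q⁻¹ / b ^ (σ : ℤ) with hM
  have hMpos : 0 < M := by positivity
  refine ⟨C + 1 + M, by positivity, fun x x' k k' hsub => ?_⟩
  have hk' : k' ≤ k + σ := by
    have h1 := measure_mono (μ := volume) hsub
    rwa [h.volume_ballOf, h.volume_ballOf, ENNReal.ofReal_le_ofReal_iff (h.zpow_pos _).le,
      zpow_le_zpow_iff_right₀ h.one_lt] at h1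
  have hχ := H.chiNorm_pos h x k
  have hθ := h.zpow_pos (k' - k)
  have reduce : ∀ K : ℝ, K ≤ C + 1 + M →
      chiNorm p (ballOf S x' k') ≤ K * b ^ (k' - k) * chiNorm p (ballOf S x k) →
      chiNorm p (ballOf S x' k') ≤ (C + 1 + M) * b ^ (k' - k) * chiNorm p (ballOf S x k) :=
    fun K hK hle => hle.trans (by gcongr)
  rcases le_or_gt k 0 with hk | hk
  · exact reduce C (by linarith) (hsmall x x' k k' hk hk' hsub)
  -- When scale `0` separates the two balls, each norm is compared with the measure of its ball.
  rcases le_or_gt k' 0 with hk0 | hk0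
  · refine reduce 1 (by linarith) ?_
    calc chiNorm p (ballOf S x' k') ≤ b ^ k' := H.chiNorm_le_zpow h x' hk0
      _ = 1 * b ^ (k' - k) * b ^ k := by
          rw [one_mul, ← zpow_add₀ h.b_pos.ne', sub_add_cancel]
      _ ≤ 1 * b ^ (k' - k) * chiNorm p (ballOf S x k) := by
          gcongr; exact H.zpow_le_chiNorm h x hk.le
  · refine reduce M (by linarith) ?_
    set τ : ℝ := b ^ (k' - k - σ) with hτ
    have hτ0 : 0 < τ := h.zpow_pos _
    have hτ1 : τ ≤ 1 := zpow_le_one_of_nonpos₀ h.one_lt.le (by omega)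
    have e1 : b ^ k' = τ * b ^ (σ : ℤ) * b ^ k := by
      rw [hτ, ← zpow_add₀ h.b_pos.ne', ← zpow_add₀ h.b_pos.ne']; congr 1; ring
    have e2 : b ^ (k' - k) = τ * b ^ (σ : ℤ) := by
      rw [hτ, ← zpow_add₀ h.b_pos.ne']; congr 1; ring
    have hV := h.zpow_pos k
    -- At large scales both norms behave like measure to the power `1 / q`; `q ≤ 1` makes the ratio
    -- of norms at most linear in the ratio of measures.
    have e3 : τ ^ q⁻¹ ≤ τ := by
      simpa using Real.rpow_le_rpow_of_exponent_ge hτ0 hτ1 ((one_le_inv₀ hq).2 H.le_one)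
    calc chiNorm p (ballOf S x' k') ≤ D * (b ^ k') ^ q⁻¹ := hup x' k' hk0.le
      _ = D * (τ ^ q⁻¹ * (b ^ (σ : ℤ)) ^ q⁻¹ * (b ^ k) ^ q⁻¹) := by
          rw [e1, Real.mul_rpow (by positivity) hV.le, Real.mul_rpow hτ0.le hbσ.le]
      _ ≤ D * (τ * (b ^ (σ : ℤ)) ^ q⁻¹ * (chiNorm p (ballOf S x k) / c)) := by
          gcongr
          rw [le_div_iff₀' hc]
          exact hlow x k hk.le
      _ = M * b ^ (k' - k) * chiNorm p (ballOf S x k) := by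
          rw [e2, hM]; field_simp

end LogHolderScale

end CharacteristicNorm

end AnisoBMO

/-! ### Assembling the inequality -/

namespace AnisoBMO

open MeasureTheory Filter Topology
open scoped ENNReal Pointwise

variable {𝕜 : Type*} [RCLike 𝕜] {n : ℕ} {A : Matrix (Fin n) (Fin n) ℝ} {Δ : Set (Fin n → ℝ)}

theorem IsLqLoc.locallyIntegrable {f : (Fin n → ℝ) → 𝕜} (hf : IsLqLoc 1 f) :
    LocallyIntegrable f := by
  refine locallyIntegrable_iff.2 fun K hK => ?_
  have := hf K hK
  rw [ENNReal.ofReal_one] at this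
  exact memLp_one_iff_integrable.1 this

/-- Near-optimal polynomials on a ball. -/
theorem exists_poly_lintegral_le {p : (Fin n → ℝ) → ℝ} {s : ℕ} {f : (Fin n → ℝ) → 𝕜}
    (hf : MemBMO A Δ p 1 s f) {B : Set (Fin n → ℝ)} (hB : B ∈ dilatedBalls A Δ)
    (hχ : 0 < chiNorm p B) {ε : ℝ} (hε : 0 < ε) :
    ∃ P : MvPolynomial (Fin n) 𝕜, P.totalDegree ≤ s ∧
      ∫⁻ z in B, ‖f z - polyEval P z‖ₑ ≤
        ENNReal.ofReal ((bmoNorm A Δ p 1 s f + ε) * chiNorm p B) := by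
  have h1 : (⨅ (P : MvPolynomial (Fin n) 𝕜) (_ : P.totalDegree ≤ s),
      ENNReal.ofReal (volume.real B ^ (1 - 1 / (1 : ℝ)) / chiNorm p B) *
        (∫⁻ x in B, ‖f x - polyEval P x‖ₑ ^ (1 : ℝ)) ^ (1 / (1 : ℝ))) <
      ENNReal.ofReal (bmoNorm A Δ p 1 s f + ε) := by
    refine lt_of_le_of_lt (le_iSup₂ (f := fun B (_ : B ∈ dilatedBalls A Δ) =>
      ⨅ (P : MvPolynomial (Fin n) 𝕜) (_ : P.totalDegree ≤ s),
      ENNReal.ofReal (volume.real B ^ (1 - 1 / (1 : ℝ)) / chiNorm p B) *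
        (∫⁻ x in B, ‖f x - polyEval P x‖ₑ ^ (1 : ℝ)) ^ (1 / (1 : ℝ))) B hB) ?_
    change bmoENorm A Δ p 1 s f < _
    rw [ENNReal.lt_ofReal_iff_toReal_lt hf.2.ne]
    exact lt_add_of_pos_right _ hε
  simp only [iInf_lt_iff] at h1
  obtain ⟨P, hP, hlt⟩ := h1
  refine ⟨P, hP, ?_⟩
  simp only [ENNReal.rpow_one, div_one, sub_self, Real.rpow_zero] at hlt
  have hM : 0 ≤ bmoNorm A Δ p 1 s f + ε := add_nonneg ENNReal.toReal_nonneg hε.le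
  rw [one_div, ENNReal.ofReal_inv_of_pos hχ] at hlt
  rw [ENNReal.ofReal_mul hM, mul_comm]
  exact ((ENNReal.inv_mul_le_iff (by simpa using hχ) ENNReal.ofReal_ne_top).1 hlt.le)

/-- The factor `4 = 2²` pays for two lost units: rounding the height down, and one round reserved
for changing the polynomial. -/
theorem two_pow_inv_le_exp {m : ℕ} {z : ℝ} (hz : z ≤ m + 2) :
    (2⁻¹ : ℝ) ^ m ≤ 4 * Real.exp (-(Real.log 2 * z)) := by
  have h1 : (2⁻¹ : ℝ) ^ m = 4 * Real.exp (-(Real.log 2 * (m + 2))) := by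
    rw [show -(Real.log 2 * (m + 2)) = (m + 2 : ℕ) * -Real.log 2 by push_cast; ring,
      Real.exp_nat_mul, Real.exp_neg, Real.exp_log two_pos, pow_add]
    ring
  rw [h1]
  have := Real.log_pos one_lt_two
  gcongr

/-- The John–Nirenberg inequality with an arbitrary bound exceeding the `BMO` norm. -/
theorem exists_john_nirenberg (hn : 1 ≤ n) (hΔ : IsUnitEllipsoid A Δ) {p : (Fin n → ℝ) → ℝ}
    (hp : IsLogHolder A Δ p) (hp1 : pPlus p ≤ 1) (s : ℕ) :
    ∃ c : ℝ, 0 < c ∧ ∀ f : (Fin n → ℝ) → 𝕜, MemBMO A Δ p 1 s f →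
      ∀ B ∈ dilatedBalls A Δ, 0 < chiNorm p B ∧ 0 < volume.real B ∧
        ∀ lam : ℝ, 0 < lam → ∀ ε : ℝ, 0 < ε →
        volume {x | x ∈ B ∧ lam < ‖f x - polyEval (minimizingPoly B s f) x‖} ≤
          ENNReal.ofReal (4 * volume.real B * Real.exp (-(c * lam * volume.real B /
            ((bmoNorm A Δ p 1 s f + ε) * chiNorm p B)))) := by
  obtain ⟨σ, h⟩ := hΔ.exists_ballScale hn
  obtain ⟨pm, q, C₀, C₁, H⟩ := exists_logHolderScale h hp hp1
  obtain ⟨D, hD, hχ⟩ := H.exists_chiNorm_le h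
  obtain ⟨C, hC, hpoly⟩ := exists_norm_polyEval_ballOf_le (𝕜 := 𝕜) hΔ s
  set b := |A.det| with hb
  set S := ballAt A Δ with hS
  set L := BallScale.jnConst b C σ with hL
  have hLpos : 0 < L := h.jnConst_pos C
  have hbσ := h.zpow_pos σ
  set Λ := L + C with hΛ
  have hΛpos : 0 < Λ := by positivity
  have hlog2 := Real.log_pos one_lt_two
  refine ⟨Real.log 2 / (Λ * D * b ^ (σ : ℤ)), by positivity, fun f hf B hB => ?_⟩
  obtain ⟨x₀, k₀, rfl⟩ := mem_dilatedBalls.1 hB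
  have hχpos := H.chiNorm_pos h x₀ k₀
  have hV := h.zpow_pos k₀
  have hvol : volume.real (ballOf S x₀ k₀) = b ^ k₀ := by
    rw [measureReal_def, h.volume_ballOf, ENNReal.toReal_ofReal hV.le]
  rw [hvol]
  refine ⟨hχpos, hV, fun lam hlam ε hε => ?_⟩
  set χ := chiNorm p (ballOf S x₀ k₀) with hχdef
  set M := bmoNorm A Δ p 1 s f with hM
  have hM0 : 0 ≤ M := ENNReal.toReal_nonneg
  have hMε : 0 < M + ε := by linarith
  set N := (M + ε) * (D * b ^ (σ : ℤ) * b ^ (-k₀) * χ) with hN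
  have hNpos : 0 < N := by
    have := h.zpow_pos (-k₀)
    positivity
  have hloc := hf.1.locallyIntegrable
  set 𝒬 : Set ((Fin n → ℝ) → 𝕜) :=
    {Q | ∃ P : MvPolynomial (Fin n) 𝕜, P.totalDegree ≤ s ∧ Q = polyEval P} with h𝒬
  have hcont : ∀ Q ∈ 𝒬, Continuous Q := by
    rintro _ ⟨P, -, rfl⟩
    exact continuous_polyEval P
  have hsup : ∀ Q ∈ 𝒬, ∀ Q' ∈ 𝒬, ∀ x k, ∀ y ∈ ballOf S x k,
      ‖Q y - Q' y‖ₑ * ENNReal.ofReal (b ^ k) ≤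
        ENNReal.ofReal C * ∫⁻ z in ballOf S x k, ‖Q z - Q' z‖ₑ := by
    rintro _ ⟨P, hP, rfl⟩ _ ⟨P', hP', rfl⟩ x k y hy
    have := hpoly x k (P - P') (polyEval (P - P'))
      ((MvPolynomial.totalDegree_sub _ _).trans (max_le hP hP'))
      (integrableOn_of_continuous (h.isBounded_ballOf x k) (continuous_polyEval _))
      (fun _ _ => rfl) y hy
    simpa using this
  have hosc : ∀ x k, ballOf S x (k + σ) ⊆ ballOf S x₀ (k₀ + σ) → ∃ Q ∈ 𝒬,
      ∫⁻ z in ballOf S x (k + σ), ‖f z - Q z‖ₑ ≤ ENNReal.ofReal N * ENNReal.ofReal (b ^ k) := by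
    intro x k hsub
    obtain ⟨P, hP, hle⟩ := exists_poly_lintegral_le hf (mem_dilatedBalls.2 ⟨x, k + σ, rfl⟩)
      (H.chiNorm_pos h x (k + σ)) hε
    refine ⟨_, ⟨P, hP, rfl⟩, hle.trans ?_⟩
    rw [← ENNReal.ofReal_mul hNpos.le]
    refine ENNReal.ofReal_le_ofReal ?_
    calc _ ≤ (M + ε) * (D * b ^ (k + σ - k₀) * χ) := by
          gcongr
          exact hχ x₀ x k₀ (k + σ) hsub
      _ = N * b ^ k := by
          rw [hN, sub_eq_add_neg, zpow_add₀ h.b_pos.ne', zpow_add₀ h.b_pos.ne']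
          ring
  obtain ⟨Q, hQ, hQN⟩ := hosc x₀ k₀ subset_rfl
  have hiter := fun m : ℕ => h.john_nirenberg_iterate hloc hcont hC hsup hNpos hosc m x₀ k₀
    subset_rfl Q hQ hQN
  obtain ⟨P, hP, rfl⟩ := hQ
  set R := minimizingPoly (ballOf S x₀ k₀) s f with hR
  have hRmin : IsMinimizingPoly (ballOf S x₀ k₀) s f R :=
    isMinimizingPoly_minimizingPoly (h.isOpen_ballOf x₀ k₀) ⟨x₀, h.mem_self x₀ k₀⟩
      (h.isBounded_ballOf x₀ k₀) s (h.integrableOn_ballOf hloc x₀ k₀)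
  have hRP : ∀ y ∈ ballOf S x₀ k₀, ‖polyEval R y - polyEval P y‖ ≤ C * N := by
    intro y hy
    have hbd := h.isBounded_ballOf x₀ k₀
    have hms := h.measurableSet_ballOf x₀ k₀
    have hfi := h.integrableOn_ballOf hloc x₀ k₀
    have hPi : ∀ P : MvPolynomial (Fin n) 𝕜, IntegrableOn (polyEval P) (ballOf S x₀ k₀) :=
      fun P => integrableOn_of_continuous hbd (continuous_polyEval P)
    -- By the defining orthogonality of `R`, the polynomial `R - P` has the same moments as `f - P`.
    have h1 := hpoly x₀ k₀ (R - P) (fun z => f z - polyEval P z)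
      ((MvPolynomial.totalDegree_sub _ _).trans (max_le hRmin.1 hP)) (hfi.sub (hPi P))
      (fun t ht => by
        have h2 := hRmin.2 t ht
        have e1 : IntegrableOn (fun z => polyEval t z * (f z - polyEval P z)) (ballOf S x₀ k₀) :=
          integrableOn_polyEval_mul hms hbd t (hfi.sub (hPi P))
        have e2 : IntegrableOn (fun z => polyEval t z * (f z - polyEval R z)) (ballOf S x₀ k₀) :=
          integrableOn_polyEval_mul hms hbd t (hfi.sub (hPi R))
        calc ∫ z in ballOf S x₀ k₀, polyEval t z * polyEval (R - P) z
            = ∫ z in ballOf S x₀ k₀, (polyEval t z * (f z - polyEval P z) -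
                polyEval t z * (f z - polyEval R z)) := by
              congr 1; ext z; rw [polyEval_sub]; ring
          _ = _ := by rw [integral_sub e1 e2, h2, sub_zero]) y hy
    have h3 : ∫⁻ z in ballOf S x₀ k₀, ‖f z - polyEval P z‖ₑ ≤
        ENNReal.ofReal N * ENNReal.ofReal (b ^ k₀) :=
      (lintegral_mono_set (h.ballOf_mono x₀ (by omega))).trans hQN
    have h4 := h1.trans (mul_le_mul_right h3 _)
    rwa [← mul_assoc, ENNReal.mul_le_mul_iff_left (h.ofReal_zpow_ne_zero k₀)
      ENNReal.ofReal_ne_top, ← ENNReal.ofReal_mul hC, ← ofReal_norm,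
      ENNReal.ofReal_le_ofReal_iff (by positivity), polyEval_sub] at h4
  set z := lam / (Λ * N) with hz
  have hz0 : 0 < z := by positivity
  have hexp : Real.log 2 / (Λ * D * b ^ (σ : ℤ)) * lam * b ^ k₀ / ((M + ε) * χ) =
      Real.log 2 * z := by
    have := h.zpow_pos k₀
    rw [hz, hN, zpow_neg]
    field_simp
  rw [hexp]
  have hbound : ∀ m : ℕ, z ≤ m + 2 →
      2⁻¹ ^ m * ENNReal.ofReal (b ^ k₀) ≤
        ENNReal.ofReal (4 * b ^ k₀ * Real.exp (-(Real.log 2 * z))) := by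
    intro m hm
    have e : (2⁻¹ : ℝ≥0∞) ^ m = ENNReal.ofReal ((2⁻¹ : ℝ) ^ m) := by
      rw [ENNReal.ofReal_pow (by norm_num), ENNReal.ofReal_inv_of_pos two_pos,
        ENNReal.ofReal_ofNat]
    rw [e, ← ENNReal.ofReal_mul (by positivity)]
    refine ENNReal.ofReal_le_ofReal ?_
    have := two_pow_inv_le_exp hm
    calc _ ≤ 4 * Real.exp (-(Real.log 2 * z)) * b ^ k₀ := by gcongr
      _ = _ := by ring
  rcases lt_or_ge z 1 with hz1 | hz1
  · refine le_trans ?_ (hbound 0 (by push_cast; linarith))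
    rw [pow_zero, one_mul, ← h.volume_ballOf x₀ k₀]
    exact measure_mono fun y hy => hy.1
  · obtain ⟨m, hm⟩ : ∃ m : ℕ, ⌊z⌋₊ = m + 1 :=
      Nat.exists_eq_succ_of_ne_zero (Nat.floor_pos.2 hz1).ne'
    have hm1 : (m + 1 : ℝ) ≤ z := by
      have := Nat.floor_le hz0.le
      rw [hm] at this
      exact_mod_cast this
    have hm2 : z ≤ m + 2 := by
      have := Nat.lt_floor_add_one z
      rw [hm] at this
      push_cast at this
      linarith
    refine le_trans (measure_mono ?_) ((hiter m).trans (hbound m hm2))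
    rintro y ⟨hy1, hy2⟩
    refine ⟨hy1, ?_⟩
    have h1 : (m + 1) * (Λ * N) ≤ lam := by
      rwa [hz, le_div_iff₀ (by positivity)] at hm1
    have h2 := hRP y hy1
    have h3 : ‖f y - polyEval R y‖ ≤ ‖f y - polyEval P y‖ + ‖polyEval R y - polyEval P y‖ := by
      simpa using norm_sub_le (f y - polyEval P y) (polyEval R y - polyEval P y)
    -- The iteration after `m` rounds uses height `m L N`, and passing from `P` to `R` uses `C N`;
    -- `Λ = L + C` fits both below `(m + 1) Λ N`.
    have h4 : m * (L * N) + C * N ≤ (m + 1) * (Λ * N) := by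
      have e1 : 0 ≤ m * (C * N) := by positivity
      have e2 : 0 ≤ L * N := by positivity
      rw [hΛ]
      linarith
    linarith

end AnisoBMO

theorem corollaryc5 {𝕜 : Type*} [RCLike 𝕜] (n : ℕ) (hn : 1 ≤ n)
    (A : Matrix (Fin n) (Fin n) ℝ) (hA : AnisoBMO.IsDilation A)
    (lm : ℝ) (hlm : AnisoBMO.IsLambdaMinus A lm)
    (Δ : Set (Fin n → ℝ)) (hΔ : AnisoBMO.IsUnitEllipsoid A Δ)
    (p : (Fin n → ℝ) → ℝ) (hp : AnisoBMO.IsLogHolder A Δ p)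
    (hp1 : AnisoBMO.pPlus p ∈ Set.Ioc (0 : ℝ) 1)
    (s : ℕ)
    (hs : ⌊(1 / AnisoBMO.pMinus p - 1) * (Real.log |A.det| / Real.log lm)⌋ ≤ (s : ℤ)) :
    ∃ c₁ c₂ : ℝ, 0 < c₁ ∧ 0 < c₂ ∧
      ∀ f : (Fin n → ℝ) → 𝕜, AnisoBMO.MemBMO A Δ p 1 s f →
        ∀ B ∈ AnisoBMO.dilatedBalls A Δ, ∀ lam : ℝ, 0 < lam →
          MeasureTheory.volume
              {x | x ∈ B ∧
                lam < ‖f x - AnisoBMO.polyEval (AnisoBMO.minimizingPoly B s f) x‖} ≤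
            ENNReal.ofReal (c₁ * MeasureTheory.volume.real B *
              Real.exp (-(c₂ * lam * MeasureTheory.volume.real B /
                (AnisoBMO.bmoNorm A Δ p 1 s f * AnisoBMO.chiNorm p B)))) ∧
          (AnisoBMO.bmoNorm A Δ p 1 s f = 0 →
            MeasureTheory.volume
              {x | x ∈ B ∧
                lam < ‖f x - AnisoBMO.polyEval (AnisoBMO.minimizingPoly B s f) x‖} = 0) := by
  obtain ⟨c, hc, hjn⟩ := AnisoBMO.exists_john_nirenberg (𝕜 := 𝕜) hn hΔ hp hp1.2 s
  refine ⟨4, c / 2, by norm_num, by positivity, fun f hf B hB lam hlam => ?_⟩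
  obtain ⟨hχ, hV, hle⟩ := hjn f hf B hB
  have hnull : AnisoBMO.bmoNorm A Δ p 1 s f = 0 → MeasureTheory.volume
      {x | x ∈ B ∧
        lam < ‖f x - AnisoBMO.polyEval (AnisoBMO.minimizingPoly B s f) x‖} = 0 := by
    intro h0
    set V := MeasureTheory.volume.real B
    set χ := AnisoBMO.chiNorm p B
    have hlim : Filter.Tendsto (fun j : ℕ => ENNReal.ofReal (4 * V * Real.exp (-((j : ℝ) + 1))))
        Filter.atTop (nhds 0) := by
      have h1 : Filter.Tendsto (fun j : ℕ => (j : ℝ) + 1) Filter.atTop Filter.atTop :=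
        Filter.tendsto_atTop_add_const_right _ _ tendsto_natCast_atTop_atTop
      have h2 := (Real.tendsto_exp_neg_atTop_nhds_zero.comp h1).const_mul (4 * V)
      rw [mul_zero] at h2
      simpa using ENNReal.tendsto_ofReal h2
    refine le_antisymm (ge_of_tendsto' hlim fun j => ?_) (zero_le)
    -- This `ε` makes the exponent exactly `-(j + 1)`.
    have h3 := hle lam hlam (c * lam * V / χ / ((j : ℝ) + 1)) (by positivity)
    have h4 : c * lam * V / ((AnisoBMO.bmoNorm A Δ p 1 s f +
        c * lam * V / χ / ((j : ℝ) + 1)) * χ) = (j : ℝ) + 1 := by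
      rw [h0, zero_add]
      field_simp
    rwa [h4] at h3
  refine ⟨?_, hnull⟩
  rcases (ENNReal.toReal_nonneg : 0 ≤ AnisoBMO.bmoNorm A Δ p 1 s f).eq_or_lt with h0 | h0
  · rw [hnull h0.symm]
    exact zero_le
  · have h1 := hle lam hlam _ h0
    have h2 : c / 2 * lam * MeasureTheory.volume.real B /
        (AnisoBMO.bmoNorm A Δ p 1 s f * AnisoBMO.chiNorm p B) =
        c * lam * MeasureTheory.volume.real B /
        ((AnisoBMO.bmoNorm A Δ p 1 s f + AnisoBMO.bmoNorm A Δ p 1 s f) *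
          AnisoBMO.chiNorm p B) := by
      rw [← two_mul]
      field_simp
    rwa [h2]
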